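/- Cardinals are identified with their initial ordinals; ${}^{\omega>}\kappa$ is the set of finite sequences of ordinals below $\kappa$, $\nu^\frown\rho$ is concatenation, and $\lambda$ denotes an infinite cardinal. $Pr_1(\kappa,\mu,\theta,\sigma)$ means: there is a symmetric function $d:\kappa\times\kappa\to\theta$ such that for all pairwise disjoint sets $u_\alpha\subseteq\kappa$ ($\alpha<\mu$) with $|u_\alpha|<\sigma$ and all $\gamma<\theta$ there are $\alpha<\beta<\mu$ with $d(\zeta,\xi)=\gamma$ for all $\zeta\in u_\alpha$, $\xi\in u_\beta$. $Pr_6(\kappa,\kappa,\theta,\sigma)$ means: there is $d:{}^{\omega>}\kappa\to\theta$ such that whenever $u_\alpha,v_\alpha\subseteq{}^{\omega>}\kappa$ ($\alpha<\kappa$) satisfy $|u_\alpha\cup v_\alpha|<\sigma$ and $\alpha\in\mathrm{Rang}(\nu)$ for all $\nu\in u_\alpha\cup v_\alpha$, and $\gamma<\theta$ and $E$ is a club of $\kappa$, there are $\alpha<\beta$ in $E$ with $d(\nu^\frown\rho)=\gamma$ for all $\nu\in u_\alpha$, $\rho\in v_\beta$. Variants: $Pr^6_S(\kappa,\kappa,\theta,\sigma)$,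 for $S\subseteq\kappa$, requires $\alpha,\beta\in E\cap S$ instead of $\alpha,\beta\in E$; $Pr^6_\tau(\kappa,\kappa,\theta,\sigma)$ means $Pr^6_S(\kappa,\kappa,\theta,\sigma)$ for some stationary $S\subseteq\{\delta<\kappa:\mathrm{cf}(\delta)\ge\tau\}$; $Pr^6(\kappa,\kappa,\theta,\sigma)$ is $Pr^6_\sigma(\kappa,\kappa,\theta,\sigma)$; $Pr^6_{\mathrm{nacc}}(\kappa,\kappa,\theta,\sigma)$ requires that $\alpha,\beta$ are points of $E$ which are not limits of smaller points of $E$; $Pr_6^-(\kappa,\kappa,\theta,\sigma)$ considers only $E=\kappa$. **Lemma.** (0) Let $1\le\theta_1\le\theta$ and $\sigma_1\le\sigma$. Then $Pr_6(\kappa,\kappa,\theta,\sigma)$ implies $Pr_6(\kappa,\kappa,\theta_1,\sigma_1)$, and likewise for $Pr^6$, $Pr^6_{\mathrm{nacc}}$ and $Pr_6^-$; moreover $Pr^6_S(\kappa,\kappa,\theta,\sigma)$ implies $Pr^6_{S_1}(\kappa,\kappa,\theta_1,\sigma_1)$ for $S\subseteq S_1\subseteq\kappa$, and $Pr^6_\tau(\kappa,\kappa,\theta,\sigma)$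 implies $Pr^6_{\tau_1}(\kappa,\kappa,\theta_1,\sigma_1)$ for $\tau_1\le\tau$. In the definition of $Pr_6$ and of each of its variants, a function $d$ is as required if and only if it is as required for all families with $u_\alpha=v_\alpha$ for every $\alpha$. More generally this holds when the sets in which $\alpha<\beta$ have to be found range over any given family $T$ of subsets of $\kappa$. (1) If $Pr_6(\lambda^+,\lambda^+,\lambda^+,\lambda)$, then $Pr_1(\lambda^{++},\lambda^{++},\lambda^{++},\lambda)$. (2) Let $Pr_6(\lambda^+,\lambda^+,\theta,\sigma)$ hold. Then $\theta\le\lambda^+$ if $\sigma\ge2$; and $Pr_1(\lambda^{++},\lambda^{++},\lambda^{++},\sigma)$ holds provided that $(*)$ there is a sequence $\langle A_\alpha:\alpha<\lambda^{++}\rangle$ of subsets of $\theta$ such that $A_\alpha\setminus\bigcup\{A_\beta:\beta\in u,\ \beta\ne\alpha\}\ne\emptyset$ whenever $\alpha\in u\subseteq\lambda^{++}$ and $|u|<\sigma$. Condition $(*)$ always holds for $\theta=\lambda^+$ and $\sigma=\lambda$. (3) If $\lambda$ is regular and $\lambda^{<\lambda}=\lambda$, then $Pr_6(\lambda^+,\lambda^+,\lambda^+,\lambda)$.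 -/

import Mathlib

universe u

open scoped Cardinal

namespace ShelahPr

/-- The set of ordinals below (the initial ordinal of) the cardinal `κ`, as a well-ordered type. -/
abbrev Below (κ : Cardinal.{u}) : Type u := κ.ord.ToType

/-- `Pr₁(κ, μ, θ, σ)`: there is a symmetric `d : κ × κ → θ` such that for all pairwise disjoint
`u α ⊆ κ` (`α < μ`) of size `< σ` and all `γ < θ`, there are `α < β < μ` such that `d` is
constantly `γ` on `u α × u β`. -/
def Pr1 (κ μ θ σ : Cardinal.{u}) : Prop :=
  ∃ d : Below κ → Below κ → Below θ,
    (∀ ζ ξ, d ζ ξ = d ξ ζ) ∧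
    ∀ u : Below μ → Set (Below κ),
      (∀ α, #(u α) < σ) →
      (∀ α β, α < β → Disjoint (u α) (u β)) →
      ∀ γ : Below θ, ∃ α β, α < β ∧ ∀ ζ ∈ u α, ∀ ξ ∈ u β, d ζ ξ = γ

/-- The common core of `Pr₆` and its variants, for a colouring `d` of the finite sequences of
ordinals below `κ` and a family `T` of subsets of `κ`: whenever `u α`, `v α` (`α < κ`) are sets of
finite sequences that contain `α`, with `|u α ∪ v α| < σ`, and `γ < θ`, `E ∈ T`, there are `α < β`
from `E` with `d (ν ⌢ ρ) = γ` for all `ν ∈ u α`, `ρ ∈ v β`. -/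
def Realizes {κ θ : Cardinal.{u}} (d : List (Below κ) → Below θ) (σ : Cardinal.{u})
    (T : Set (Set (Below κ))) : Prop :=
  ∀ u v : Below κ → Set (List (Below κ)),
    (∀ α, #(u α ∪ v α : Set (List (Below κ))) < σ) →
    (∀ α, ∀ ν ∈ u α ∪ v α, α ∈ ν) →
    ∀ γ : Below θ, ∀ E ∈ T,
      ∃ α ∈ E, ∃ β ∈ E, α < β ∧ ∀ ν ∈ u α, ∀ ρ ∈ v β, d (ν ++ ρ) = γ

/-- The same requirement, restricted to the sequences `(u α, v α)` with `u α = v α`. -/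
def RealizesDiag {κ θ : Cardinal.{u}} (d : List (Below κ) → Below θ) (σ : Cardinal.{u})
    (T : Set (Set (Below κ))) : Prop :=
  ∀ u : Below κ → Set (List (Below κ)),
    (∀ α, #(u α) < σ) →
    (∀ α, ∀ ν ∈ u α, α ∈ ν) →
    ∀ γ : Below θ, ∀ E ∈ T,
      ∃ α ∈ E, ∃ β ∈ E, α < β ∧ ∀ ν ∈ u α, ∀ ρ ∈ u β, d (ν ++ ρ) = γ

/-- `Pr₆(κ, κ, θ, σ)`: `α < β` are found in every club `E` of `κ`. -/
def Pr6 (κ θ σ : Cardinal.{u}) : Prop :=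
  ∃ d : List (Below κ) → Below θ, Realizes d σ {E | IsClub E}

/-- `Pr⁶_S(κ, κ, θ, σ)`: `α < β` are found in `E ∩ S` for every club `E` of `κ`. -/
def Pr6Set (κ θ σ : Cardinal.{u}) (S : Set (Below κ)) : Prop :=
  ∃ d : List (Below κ) → Below θ, Realizes d σ {B | ∃ E, IsClub E ∧ B = E ∩ S}

/-- `Pr⁶_τ(κ, κ, θ, σ)`: `Pr⁶_S(κ, κ, θ, σ)` for some stationary `S ⊆ {δ < κ : cf δ ≥ τ}`. -/
def Pr6Cof (κ θ σ τ : Cardinal.{u}) : Prop :=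
  ∃ S : Set (Below κ), IsStationary S ∧ (∀ δ ∈ S, τ ≤ Order.cof (Set.Iio δ)) ∧ Pr6Set κ θ σ S

/-- `Pr⁶(κ, κ, θ, σ)`: the case `τ = σ`. -/
def Pr6CofSelf (κ θ σ : Cardinal.{u}) : Prop :=
  Pr6Cof κ θ σ σ

/-- The points of `E` that are not limits of smaller points of `E`. -/
def nacc {κ : Cardinal.{u}} (E : Set (Below κ)) : Set (Below κ) :=
  {δ ∈ E | ¬ ((E ∩ Set.Iio δ).Nonempty ∧ IsLUB (E ∩ Set.Iio δ) δ)}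

/-- `Pr⁶_nacc(κ, κ, θ, σ)`: `α < β` are found in `nacc E` for every club `E` of `κ`. -/
def Pr6Nacc (κ θ σ : Cardinal.{u}) : Prop :=
  ∃ d : List (Below κ) → Below θ, Realizes d σ {B | ∃ E, IsClub E ∧ B = nacc E}

/-- `Pr₆⁻(κ, κ, θ, σ)`: only `E = κ` is considered. -/
def Pr6Minus (κ θ σ : Cardinal.{u}) : Prop :=
  ∃ d : List (Below κ) → Below θ, Realizes d σ {Set.univ}

/-- There are subsets `A α` of `θ` (`α < μ`) such that for `α ∈ w ⊆ μ` with `|w| < σ`, the set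
`A α` is not covered by the union of the `A β` with `β ∈ w`, `β ≠ α`. -/
def HasUncoveredFamily (μ θ σ : Cardinal.{u}) : Prop :=
  ∃ A : Below μ → Set (Below θ),
    ∀ w : Set (Below μ), #w < σ → ∀ α ∈ w, (A α \ ⋃ β ∈ w \ {α}, A β).Nonempty

end ShelahPr

namespace ShelahPr

open Cardinal Set

/-! ### Regular cardinals as well-ordered types -/

section Regular

variable {κ : Cardinal.{u}}

/-! Everything rests on walks on a successor `ν⁺` of a regular `ν`. A walk from `ξ` to `ζ < ξ` moves
at each step to the point of `[ζ, ξ)` of least rank under an injection of the predecessors of the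
current point into `ν`. If `δ` has cofinality `ν`, the points of bounded rank cannot accumulate at
`δ`, so walks from above `δ` to points close below `δ` pass through `δ` (`exists_walk_eq_append`).

For (3), attach distinct elements of `2^λ` to the ordinals below `λ⁺` and let `h` have all its
fibres stationary in cofinality `λ`. A sequence gets the `h`-value of the first point of a walk
between its entries where the rank of the next step suffices to separate the entries. Given a
colour, take `δ` with this `h`-value, `β` above `δ`, and `α` just below `δ` that looks like `β` up
to a level beyond all ranks used above `δ`. Steps before `δ` cannot tell `α` from `β`, while the
step at `δ` has as large a rank as desired; so `δ` decides (`isCritical_append_iff`). As `λ^{<λ} =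
λ`, there are only `λ` many types, which is why such an `α` exists below `δ`.

For (1) and (2), put `κ = λ⁺` and walk on `κ⁺`. Each point carries a letter below `κ` and a label
below `κ⁺`. The `Pr6` function, applied to the letters of a walk, yields some `γ < θ`; a walk
splitting at `δ` is a concatenation, so any `γ` can be enforced (`exists_pair_of_upper_members`).
Then `γ` selects the first `β` on the walk with `γ ∈ A β`, whose label is the colour. As `θ ≤ κ`, a
single `γ` selects `p` for stationarily many `p` with the desired label. In (1) the sets are graphs
of eventually different functions. For `σ ≤ ℵ₀`, the function from (3) on `ω₁` and another selection
rule serve instead (`pr1_aleph0`). -/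

theorem mk_Iio_below_lt (x : Below κ) : #(Iio x) < κ := by
  simpa using Cardinal.mk_Iio_lt x (by simp)

theorem exists_forall_lt_of_mk_lt (hκ : κ.IsRegular) {s : Set (Below κ)} (hs : #s < κ) :
    ∃ b, ∀ a ∈ s, a < b := by
  rw [← not_isCofinal_iff]
  intro h
  have h₁ := Order.cof_le h
  rw [Ordinal.cof_toType, hκ.cof_ord] at h₁
  exact absurd hs h₁.not_gt

theorem exists_forall_lt_of_range (hκ : κ.IsRegular) {ι : Type u} (hι : #ι < κ)
    (f : ι → Below κ) : ∃ b, ∀ i, f i < b := by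
  obtain ⟨b, hb⟩ := exists_forall_lt_of_mk_lt hκ (mk_range_le.trans_lt hι : #(range f) < κ)
  exact ⟨b, fun i => hb _ ⟨i, rfl⟩⟩

theorem exists_below_gt (hκ : κ.IsRegular) (a : Below κ) : ∃ b, a < b := by
  obtain ⟨b, hb⟩ := exists_forall_lt_of_mk_lt hκ (s := {a})
    (by simpa using Cardinal.one_lt_aleph0.trans_le hκ.aleph0_le)
  exact ⟨b, hb a rfl⟩

theorem nonempty_below (hκ : κ ≠ 0) : Nonempty (Below κ) := by
  rwa [← mk_ne_zero_iff, mk_ord_toType]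

theorem mk_Iic_below_lt (hκ : κ.IsRegular) (x : Below κ) : #(Iic x) < κ := by
  obtain ⟨b, hb⟩ := exists_below_gt hκ x
  exact (mk_le_mk_of_subset fun y (hy : y ≤ x) => hy.trans_lt hb).trans_lt (mk_Iio_below_lt b)

end Regular

/-! ### Stationary subsets of a successor of a regular cardinal

Stationarity is expressed through closure points of functions. -/

section Stationary

variable {ν : Cardinal.{u}}

/-- The points of `ν⁺` at which fewer than `ν` smaller points are always bounded: for regular `ν`,
these are the points of cofinality `ν`. -/
def cofPoints (ν : Cardinal.{u}) : Set (Below (Order.succ ν)) :=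
  {δ | ∀ A : Set (Below (Order.succ ν)), (∀ a ∈ A, a < δ) → #A < ν → ∃ g < δ, ∀ a ∈ A, a < g}

/-- `A` contains, beyond any given point, a closure point of any given function. -/
def Stat (A : Set (Below (Order.succ ν))) : Prop :=
  ∀ (f : Below (Order.succ ν) → Below (Order.succ ν)) (b : Below (Order.succ ν)),
    ∃ δ ∈ A, b < δ ∧ ∀ a < δ, f a < δ

theorem Stat.mono {A B : Set (Below (Order.succ ν))} (hA : Stat A) (h : A ⊆ B) : Stat B :=
  fun f b => let ⟨δ, hδ, h'⟩ := hA f b; ⟨δ, h hδ, h'⟩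

theorem Stat.exists_gt {A : Set (Below (Order.succ ν))} (hA : Stat A)
    (b : Below (Order.succ ν)) : ∃ δ ∈ A, b < δ :=
  let ⟨δ, hδ, h, _⟩ := hA id b; ⟨δ, hδ, h⟩

theorem mk_Iio_succ_le (x : Below (Order.succ ν)) : #(Iio x) ≤ ν :=
  Order.lt_succ_iff.1 (mk_Iio_below_lt x)

theorem mk_Iic_succ_le (hν : ℵ₀ ≤ ν) (x : Below (Order.succ ν)) : #(Iic x) ≤ ν :=
  Order.lt_succ_iff.1 (mk_Iic_below_lt (isRegular_succ hν) x)

theorem exists_strict_bound (hν : ℵ₀ ≤ ν) {ι : Type u} (hι : #ι ≤ ν)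
    (f : ι → Below (Order.succ ν)) : ∃ b, ∀ i, f i < b :=
  exists_forall_lt_of_range (isRegular_succ hν) (Order.lt_succ_iff.2 hι) f

/-- Simultaneous domination of `ν` many functions. -/
theorem exists_dominating (hν : ℵ₀ ≤ ν) {ι : Type u} (hι : #ι ≤ ν)
    (f : ι → Below (Order.succ ν) → Below (Order.succ ν)) :
    ∃ F : Below (Order.succ ν) → Below (Order.succ ν), ∀ i a, f i a < F a := by
  choose F hF using fun a => exists_strict_bound hν hι (fun i => f i a)
  exact ⟨F, fun i a => hF a i⟩

theorem Stat.exists_closed {A : Set (Below (Order.succ ν))} (hA : Stat A) (hν : ℵ₀ ≤ ν)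
    {ι : Type u} (hι : #ι ≤ ν) (f : ι → Below (Order.succ ν) → Below (Order.succ ν))
    (b : Below (Order.succ ν)) : ∃ δ ∈ A, b < δ ∧ ∀ i, ∀ a < δ, f i a < δ := by
  obtain ⟨F, hF⟩ := exists_dominating hν hι f
  obtain ⟨δ, hδ, hb, h⟩ := hA F b
  exact ⟨δ, hδ, hb, fun i a ha => (hF i a).trans (h a ha)⟩

theorem Stat.inter_closed {A : Set (Below (Order.succ ν))} (hA : Stat A)
    (f : Below (Order.succ ν) → Below (Order.succ ν)) :
    Stat {δ ∈ A | ∀ a < δ, f a < δ} := by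
  intro g b
  obtain ⟨δ, hδ, hb, h⟩ := hA (fun a => max (f a) (g a)) b
  exact ⟨δ, ⟨hδ, fun a ha => (le_max_left _ _).trans_lt (h a ha)⟩, hb,
    fun a ha => (le_max_right _ _).trans_lt (h a ha)⟩

theorem Stat.inter_gt {A : Set (Below (Order.succ ν))} (hA : Stat A)
    (c : Below (Order.succ ν)) : Stat {δ ∈ A | c < δ} := by
  intro g b
  obtain ⟨δ, hδ, hb, h⟩ := hA g (max b c)
  exact ⟨δ, ⟨hδ, (le_max_right _ _).trans_lt hb⟩, (le_max_left _ _).trans_lt hb, h⟩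

/-- A stationary set cannot be split into `ν` many non-stationary pieces. -/
theorem Stat.exists_fiber {A : Set (Below (Order.succ ν))} (hA : Stat A) (hν : ℵ₀ ≤ ν)
    {ι : Type u} (hι : #ι ≤ ν) (P : ι → Below (Order.succ ν) → Prop)
    (hP : ∀ δ ∈ A, ∃ i, P i δ) : ∃ i, Stat {δ ∈ A | P i δ} := by
  by_contra! hcon
  simp only [Stat] at hcon
  push Not at hcon
  choose f b hf using hcon
  obtain ⟨B, hB⟩ := exists_strict_bound hν hι b
  obtain ⟨δ, hδ, hb, h⟩ := hA.exists_closed hν hι f B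
  obtain ⟨i, hi⟩ := hP δ hδ
  obtain ⟨a, ha, ha'⟩ := hf i δ ⟨hδ, hi⟩ ((hB i).trans hb)
  exact absurd (h i a ha) ha'.not_gt

theorem nonempty_below_succ (hν : ℵ₀ ≤ ν) : Nonempty (Below (Order.succ ν)) := by
  obtain ⟨δ, -⟩ := exists_strict_bound hν (ι := PEmpty) (by simp) (fun x => x.elim)
  exact ⟨δ⟩

/-- Fodor's lemma. -/
theorem Stat.exists_fiber_of_regressive {A : Set (Below (Order.succ ν))} (hA : Stat A)
    (hν : ℵ₀ ≤ ν) (P : Below (Order.succ ν) → Below (Order.succ ν) → Prop)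
    (hP : ∀ δ ∈ A, ∃ c < δ, P c δ) : ∃ c, Stat {δ ∈ A | P c δ} := by
  by_contra! hcon
  simp only [Stat] at hcon
  push Not at hcon
  choose f b hf using hcon
  -- `F a` dominates `b c` and `f c a'` for all `c, a' ≤ a`, so closure points of `F` lie in the
  -- diagonal intersection of the clubs avoiding the fibres.
  choose F hF using fun a => exists_strict_bound hν
    (ι := Iic a × Iic a)
    (by simpa using mul_le_of_le hν (mk_Iic_succ_le hν a) (mk_Iic_succ_le hν a))
    (fun p => max (b p.1) (f p.1 p.2))
  obtain ⟨b₀⟩ := nonempty_below_succ hν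
  obtain ⟨δ, hδ, hb, h⟩ := hA F b₀
  obtain ⟨c, hc, hcδ⟩ := hP δ hδ
  obtain ⟨a, ha, ha'⟩ := hf c δ ⟨hδ, hcδ⟩
    (((le_max_left _ _).trans_lt (hF c ⟨⟨c, mem_Iic.2 le_rfl⟩, ⟨c, mem_Iic.2 le_rfl⟩⟩)).trans (h c hc))
  refine absurd (((le_max_right _ _).trans_lt
    (hF (max c a) ⟨⟨c, mem_Iic.2 (le_max_left _ _)⟩, ⟨a, mem_Iic.2 (le_max_right _ _)⟩⟩)).trans
    (h (max c a) (max_lt hc ha))) ha'.not_gt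

theorem cofPoints_exists_bound {δ : Below (Order.succ ν)} (hδ : δ ∈ cofPoints ν)
    {ι : Type u} (hι : #ι < ν) (f : ι → Below (Order.succ ν)) (hf : ∀ i, f i < δ) :
    ∃ g < δ, ∀ i, f i < g := by
  obtain ⟨g, hg, h⟩ := hδ (range f) (by rintro _ ⟨i, rfl⟩; exact hf i) (mk_range_le.trans_lt hι)
  exact ⟨g, hg, fun i => h _ ⟨i, rfl⟩⟩

/-- The witness is the supremum of an increasing `ν`-sequence, each term lying above the `f`-values
at all points up to earlier terms. -/
theorem stat_cofPoints (hν : ν.IsRegular) : Stat (cofPoints ν) := by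
  intro f b
  have hν₀ := hν.aleph0_le
  choose ub hub using fun s : {s : Set (Below (Order.succ ν)) // #s ≤ ν} =>
    exists_strict_bound hν₀ s.2 (fun x : s.1 => max x.1 (f x.1))
  have hlt : ∀ (i : Below ν) (g : Iio i → Below (Order.succ ν)),
      #((insert b (⋃ j, Iic (g j)) : Set _)) ≤ ν := by
    intro i g
    refine (mk_insert_le).trans (add_le_of_le hν₀ ?_ (one_le_aleph0.trans hν₀))
    refine mk_iUnion_le_sum_mk.trans ((sum_le_mk_mul_iSup _).trans
      (mul_le_of_le hν₀ (mk_Iio_below_lt i).le (ciSup_le' fun j => mk_Iic_succ_le hν₀ _)))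
  let s : Below ν → Below (Order.succ ν) := fun i =>
    (IsWellFounded.wf (r := ((· < ·) : Below ν → Below ν → Prop))).fix
      (fun i g => ub ⟨_, hlt i (fun j => g j.1 j.2)⟩) i
  have hs : ∀ i, s i = ub ⟨_, hlt i (fun j => s j.1)⟩ := fun i => WellFounded.fix_eq _ _ _
  have hbs : ∀ i, b < s i := fun i => by
    rw [hs i]
    exact (le_max_left _ _).trans_lt (hub ⟨_, hlt i (fun j => s j.1)⟩ ⟨b, mem_insert _ _⟩)
  have hss : ∀ i j, j < i → ∀ a ≤ s j, a < s i ∧ f a < s i := fun i j hj a ha => by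
    have := hub ⟨_, hlt i (fun j => s j.1)⟩
      ⟨a, mem_insert_of_mem _ (mem_iUnion.2 ⟨⟨j, hj⟩, ha⟩)⟩
    rw [← hs i] at this
    exact ⟨(le_max_left _ _).trans_lt this, (le_max_right _ _).trans_lt this⟩
  have hne : {x | ∀ i, s i < x}.Nonempty :=
    exists_strict_bound hν₀ (ι := Below ν) (mk_ord_toType ν).le s
  have wf := (IsWellFounded.wf (r := ((· < ·) : Below (Order.succ ν) → _ → Prop)))
  let δ := wf.min _ hne
  have hδ : ∀ i, s i < δ := wf.min_mem _ hne
  have hδ' : ∀ a < δ, ∃ i, a ≤ s i := by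
    intro a ha
    by_contra! h
    exact wf.not_lt_min {x | ∀ i, s i < x} (x := a) h ha
  have : Nonempty (Below ν) := nonempty_below hν.pos.ne'
  obtain ⟨i₀⟩ := nonempty_below hν.pos.ne'
  refine ⟨δ, ?_, (hbs i₀).trans (hδ i₀), ?_⟩
  · intro A hA hAν
    choose! k hk using hδ'
    obtain ⟨m, hm⟩ := exists_forall_lt_of_range hν hAν (fun a : A => k a.1)
    refine ⟨s m, hδ m, fun a ha => (hss m (k a) (hm ⟨a, ha⟩) a (hk a (hA a ha))).1⟩
  · intro a ha
    obtain ⟨i, hi⟩ := hδ' a ha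
    obtain ⟨j, hj⟩ := exists_below_gt hν i
    exact (hss j i hj a hi).2.trans (hδ j)

/-- These injections play the role of a C-sequence: fewer than `ν` points below `x` have rank under
a given bound. -/
theorem exists_ranks (hν : ℵ₀ ≤ ν) :
    ∃ r : Below (Order.succ ν) → Below (Order.succ ν) → Below ν, ∀ x, InjOn (r x) (Iio x) := by
  have hemb : ∀ x : Below (Order.succ ν), Nonempty (Iio x ↪ Below ν) := fun x => by
    rw [← Cardinal.le_def, mk_ord_toType]; exact mk_Iio_succ_le x
  obtain ⟨i₀⟩ := nonempty_below (aleph0_pos.trans_le hν).ne'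
  classical
  refine ⟨fun x c => if h : c < x then (hemb x).some ⟨c, h⟩ else i₀, fun x a ha b hb hab => ?_⟩
  beta_reduce at hab
  rw [dif_pos (show a < x from ha), dif_pos (show b < x from hb)] at hab
  exact congrArg Subtype.val ((hemb x).some.injective hab)

/-- Ulam's theorem: the points of cofinality `ν` split into `ν⁺` many stationary sets. -/
theorem exists_stationary_partition (hν : ν.IsRegular) :
    ∃ h : Below (Order.succ ν) → Below (Order.succ ν),
      ∀ c, Stat {δ ∈ cofPoints ν | h δ = c} := by
  have hν₀ := hν.aleph0_le
  obtain ⟨r, hr⟩ := exists_ranks hν₀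
  -- An Ulam matrix: some row `i₀` is attained for `ν⁺` many `α`, and in one row the sets for
  -- different `α` are disjoint since `r δ` is injective.
  have hfib : ∀ α : Below (Order.succ ν),
      ∃ i, Stat {δ ∈ {δ ∈ cofPoints ν | α < δ} | r δ α = i} := fun α =>
    ((stat_cofPoints hν).inter_gt α).exists_fiber hν₀ (ι := Below ν) (mk_ord_toType ν).le
      (fun i δ => r δ α = i) (fun δ _ => ⟨_, rfl⟩)
  choose i hi using hfib
  obtain ⟨i₀, hi₀⟩ := infinite_pigeonhole i
    (by rw [mk_ord_toType]; exact hν₀.trans (Order.le_succ ν))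
    (by rw [mk_ord_toType, mk_ord_toType, (isRegular_succ hν₀).cof_ord]; exact Order.lt_succ ν)
  obtain ⟨e⟩ := Cardinal.eq.1 hi₀
  classical
  obtain ⟨c₀⟩ := nonempty_below_succ hν₀
  refine ⟨fun δ => if h : ∃ α : i ⁻¹' {i₀}, α.1 < δ ∧ r δ α.1 = i₀ then e h.choose else c₀,
    fun c => (hi (e.symm c).1).mono ?_⟩
  rintro δ ⟨⟨hδ, hlt⟩, hri⟩
  refine ⟨hδ, ?_⟩
  have hmem : i (e.symm c).1 = i₀ := (e.symm c).2
  have hex : ∃ α : i ⁻¹' {i₀}, α.1 < δ ∧ r δ α.1 = i₀ := ⟨e.symm c, hlt, hri.trans hmem⟩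
  have heq : hex.choose = e.symm c := Subtype.ext
    (hr δ hex.choose_spec.1 hlt (hex.choose_spec.2.trans (hri.trans hmem).symm))
  beta_reduce
  rw [dif_pos hex, heq, Equiv.apply_symm_apply]

theorem exists_closure_points_mem_club (hν : ℵ₀ ≤ ν) {E : Set (Below (Order.succ ν))}
    (hE : IsClub E) : ∃ f : Below (Order.succ ν) → Below (Order.succ ν),
      ∀ δ, (∃ a, a < δ) → (∀ a < δ, f a < δ) → δ ∈ E := by
  choose g hg using fun a => exists_below_gt (isRegular_succ hν) a
  choose f hf hf' using fun a => hE.isCofinal (g a)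
  refine ⟨f, fun δ ⟨a₀, ha₀⟩ h => ?_⟩
  refine hE.isLUB_mem (t := f '' Iio δ) ?_ ⟨_, a₀, ha₀, rfl⟩ ⟨?_, ?_⟩
  · rintro _ ⟨a, -, rfl⟩; exact hf a
  · rintro _ ⟨a, ha, rfl⟩; exact (h a ha).le
  · intro b hb
    by_contra! hlt
    exact absurd (hb ⟨b, hlt, rfl⟩) (((hg b).trans_le (hf' b)).not_ge)

end Stationary

/-! ### Walks on a successor cardinal -/

section Walk

variable {ν : Cardinal.{u}} (r : Below (Order.succ ν) → Below (Order.succ ν) → Below ν)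

/-- The step of the walk from `ξ` towards `ζ < ξ`: the point of `[ζ, ξ)` of least rank. -/
noncomputable def step (ξ ζ : Below (Order.succ ν)) : Below (Order.succ ν) :=
  open Classical in
  if h : ζ < ξ then Function.argminOn (r ξ) (Ico ζ ξ) ⟨ζ, le_rfl, h⟩ else ζ

variable {r}

theorem step_mem {ξ ζ : Below (Order.succ ν)} (h : ζ < ξ) : step r ξ ζ ∈ Ico ζ ξ := by
  rw [step, dif_pos h]
  exact Function.argminOn_mem _ _ _

theorem rank_step_le {ξ ζ c : Below (Order.succ ν)} (hc : c ∈ Ico ζ ξ) :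
    r ξ (step r ξ ζ) ≤ r ξ c := by
  rw [step, dif_pos (hc.1.trans_lt hc.2)]
  exact Function.argminOn_le _ _ hc

theorem step_eq_of_forall (hr : ∀ x, InjOn (r x) (Iio x)) {ξ ζ c : Below (Order.succ ν)}
    (hc : c ∈ Ico ζ ξ) (h : ∀ a ∈ Ico ζ ξ, r ξ c ≤ r ξ a) : step r ξ ζ = c := by
  have hm := step_mem (r := r) (hc.1.trans_lt hc.2)
  exact hr ξ hm.2 hc.2 (le_antisymm (rank_step_le hc) (h _ hm))

variable (r) in
/-- The points of the walk from `ξ` down to `ζ`, the end point `ζ` excluded. -/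
noncomputable def walk (ξ ζ : Below (Order.succ ν)) : List (Below (Order.succ ν)) :=
  open Classical in
  if _h : ζ < ξ then ξ :: walk (step r ξ ζ) ζ else []
termination_by ξ
decreasing_by exact (step_mem ‹_›).2

theorem walk_of_lt {ξ ζ : Below (Order.succ ν)} (h : ζ < ξ) :
    walk r ξ ζ = ξ :: walk r (step r ξ ζ) ζ := by
  rw [walk, dif_pos h]

theorem walk_self (ξ : Below (Order.succ ν)) : walk r ξ ξ = [] := by
  rw [walk, dif_neg (lt_irrefl _)]

theorem mem_walk_self {ξ ζ : Below (Order.succ ν)} (h : ζ < ξ) : ξ ∈ walk r ξ ζ := by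
  rw [walk_of_lt h]; exact List.mem_cons_self

theorem lt_of_mem_walk {ξ ζ p : Below (Order.succ ν)} (hp : p ∈ walk r ξ ζ) : ζ < p := by
  induction ξ using WellFoundedLT.induction with
  | ind ξ ih =>
    rcases lt_or_ge ζ ξ with h | h
    · rw [walk_of_lt h, List.mem_cons] at hp
      rcases hp with rfl | hp
      · exact h
      · exact ih _ (step_mem h).2 hp
    · rw [walk, dif_neg h.not_gt] at hp
      cases hp

/-- Below a point `δ` of cofinality `ν`, the steps of `ξ > δ` towards `δ` and towards all points
close to `δ` agree. -/
theorem exists_step_eq (hr : ∀ x, InjOn (r x) (Iio x)) {δ ξ : Below (Order.succ ν)}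
    (hδ : δ ∈ cofPoints ν) (h : δ < ξ) :
    ∃ t < δ, ∀ α, t ≤ α → α < δ → step r ξ α = step r ξ δ := by
  -- Only points below `δ` of smaller rank could divert the step; there are fewer than `ν`, so they
  -- are bounded below `δ`.
  obtain ⟨t, ht, hb⟩ := hδ {c | c < δ ∧ r ξ c < r ξ (step r ξ δ)} (fun a ha => ha.1) (by
    refine lt_of_le_of_lt ?_ (mk_Iio_below_lt (r ξ (step r ξ δ)))
    refine mk_le_of_injective (f := fun c => ⟨r ξ c.1, c.2.2⟩) fun a b hab => ?_
    exact Subtype.ext (hr ξ (a.2.1.trans h) (b.2.1.trans h) (congrArg Subtype.val hab)))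
  refine ⟨t, ht, fun α hα hαδ => ?_⟩
  have hm := step_mem (r := r) h
  refine step_eq_of_forall hr ⟨hαδ.le.trans hm.1, hm.2⟩ fun a ha => ?_
  rcases lt_or_ge a δ with haδ | haδ
  · by_contra! hlt
    exact absurd (hb a ⟨haδ, hlt⟩) (hα.trans ha.1).not_gt
  · exact rank_step_le ⟨haδ, ha.2⟩

/-- Walks towards points close below a point `δ` of cofinality `ν` pass through `δ`. -/
theorem exists_walk_eq_append (hr : ∀ x, InjOn (r x) (Iio x))
    {δ : Below (Order.succ ν)} (hδ : δ ∈ cofPoints ν) (ξ : Below (Order.succ ν)) (h : δ ≤ ξ) :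
    ∃ t < δ, ∀ α, t ≤ α → α < δ → walk r ξ α = walk r ξ δ ++ walk r δ α ∧
      ∀ p ∈ walk r ξ δ, step r p α = step r p δ := by
  have hpos : ∃ t, t < δ := by
    rcases h.eq_or_lt with rfl | hlt
    · obtain ⟨g, hg, -⟩ := hδ ∅ (by simp) (by
        have := mk_Iio_below_lt (r δ δ)
        simpa using (zero_le (a := #(Iio (r δ δ)))).trans_lt this)
      exact ⟨g, hg⟩
    · obtain ⟨t, ht, -⟩ := exists_step_eq hr hδ hlt
      exact ⟨t, ht⟩
  induction ξ using WellFoundedLT.induction with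
  | ind ξ ih =>
    rcases h.eq_or_lt with rfl | hlt
    · obtain ⟨t, ht⟩ := hpos
      exact ⟨t, ht, fun α _ _ => by simp [walk_self]⟩
    · obtain ⟨t₁, ht₁, h₁⟩ := exists_step_eq hr hδ hlt
      have hm := step_mem (r := r) hlt
      obtain ⟨t₂, ht₂, h₂⟩ := ih _ hm.2 hm.1
      refine ⟨max t₁ t₂, max_lt ht₁ ht₂, fun α hα hαδ => ?_⟩
      have e₁ := h₁ α ((le_max_left _ _).trans hα) hαδ
      obtain ⟨e₂, e₃⟩ := h₂ α ((le_max_right _ _).trans hα) hαδ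
      refine ⟨?_, ?_⟩
      · rw [walk_of_lt (hαδ.trans hlt), walk_of_lt hlt, e₁, e₂, List.cons_append]
      · intro p hp
        rw [walk_of_lt hlt, List.mem_cons] at hp
        rcases hp with rfl | hp
        · exact e₁
        · exact e₃ p hp

/-- A uniform version of `exists_walk_eq_append` for fewer than `ν` starting points. -/
theorem exists_forall_walk_eq_append (hr : ∀ x, InjOn (r x) (Iio x))
    {δ : Below (Order.succ ν)} (hδ : δ ∈ cofPoints ν) {s : Set (Below (Order.succ ν))}
    (hs : #s < ν) (h : ∀ ξ ∈ s, δ ≤ ξ) :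
    ∃ t < δ, ∀ α, t ≤ α → α < δ → ∀ ξ ∈ s, walk r ξ α = walk r ξ δ ++ walk r δ α ∧
      ∀ p ∈ walk r ξ δ, step r p α = step r p δ := by
  choose t ht h' using fun ξ : s => exists_walk_eq_append hr hδ ξ.1 (h ξ.1 ξ.2)
  obtain ⟨g, hg, hb⟩ := cofPoints_exists_bound hδ hs t ht
  exact ⟨g, hg, fun α hα hαδ ξ hξ => h' ⟨ξ, hξ⟩ α ((hb ⟨ξ, hξ⟩).le.trans hα) hαδ⟩

theorem exists_le_rank_step (hr : ∀ x, InjOn (r x) (Iio x))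
    {δ : Below (Order.succ ν)} (hδ : δ ∈ cofPoints ν) (N : Below ν) :
    ∃ t < δ, ∀ α, t ≤ α → α < δ → N ≤ r δ (step r δ α) := by
  obtain ⟨t, ht, hb⟩ := hδ {c | c < δ ∧ r δ c < N} (fun a ha => ha.1) (by
    refine lt_of_le_of_lt ?_ (mk_Iio_below_lt N)
    refine mk_le_of_injective (f := fun c => ⟨r δ c.1, c.2.2⟩) fun a b hab => ?_
    exact Subtype.ext (hr δ a.2.1 b.2.1 (congrArg Subtype.val hab)))
  refine ⟨t, ht, fun α hα hαδ => ?_⟩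
  by_contra! hlt
  have hm := step_mem (r := r) hαδ
  exact absurd (hb _ ⟨hm.2, hlt⟩) (hα.trans hm.1).not_gt

end Walk

/-! ### Eventually different functions -/

section Uncovered

variable {κ : Cardinal.{u}}

/-- For regular `κ` there are `κ⁺` many functions from `κ` to `κ` any two of which agree only on a
bounded set. -/
theorem exists_eventually_different (hκ : κ.IsRegular) :
    ∃ f : Below (Order.succ κ) → Below κ → Below κ,
      ∀ α β, α ≠ β → ∃ b, ∀ i, f α i = f β i → i < b := by
  obtain ⟨r, hr⟩ := exists_ranks hκ.aleph0_le
  have hcard : ∀ (α : Below (Order.succ κ)) (i : Below κ),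
      #{β : Below (Order.succ κ) // β < α ∧ r α β ≤ i} < κ := fun α i => by
    refine lt_of_le_of_lt ?_ (mk_Iic_below_lt hκ i)
    refine mk_le_of_injective (f := fun β => ⟨r α β.1, β.2.2⟩) fun a b hab => ?_
    exact Subtype.ext (hr α a.2.1 b.2.1 (congrArg Subtype.val hab))
  -- Recursively, `f α i` exceeds `f β i` for the fewer than `κ` many `β < α` of rank at most `i`;
  -- hence agreement with `f β` stops at the rank of `β`.
  choose ub hub using fun (α : Below (Order.succ κ)) (g : ∀ β, β < α → Below κ → Below κ)
    (i : Below κ) => exists_forall_lt_of_range hκ (hcard α i) (fun β => g β.1 β.2.1 i)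
  have wf := (IsWellFounded.wf (r := ((· < ·) : Below (Order.succ κ) → _ → Prop)))
  let f : Below (Order.succ κ) → Below κ → Below κ := wf.fix ub
  have hf : ∀ α, f α = ub α (fun β _ => f β) := fun α => WellFounded.fix_eq _ _ _
  have hlt : ∀ α β, β < α → ∀ i, f α i = f β i → i < r α β := by
    intro α β hβ i h
    by_contra! hle
    have := hub α (fun β _ => f β) i ⟨β, hβ, hle⟩
    rw [← hf α] at this
    exact absurd h this.ne'
  refine ⟨f, fun α β hne => ?_⟩
  rcases lt_or_gt_of_ne hne with h | h
  · exact ⟨_, fun i hi => hlt β α h i hi.symm⟩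
  · exact ⟨_, fun i hi => hlt α β h i hi⟩

/-- The sets are graphs of eventually different functions, coded into `κ`. Fewer than `κ` other
graphs meet a given one in bounded sets, whose bounds have a common bound by regularity. -/
theorem hasUncoveredFamily_succ (hκ : κ.IsRegular) : HasUncoveredFamily (Order.succ κ) κ κ := by
  obtain ⟨f, hf⟩ := exists_eventually_different hκ
  obtain ⟨e⟩ : Nonempty (Below κ × Below κ ≃ Below κ) := by
    rw [← Cardinal.eq]
    simpa using mul_eq_self hκ.aleph0_le
  refine ⟨fun α => range fun i => e (i, f α i), fun w hw α hα => ?_⟩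
  choose b hb using fun β : {β : w // β.1 ≠ α} => hf α β.1.1 β.2.symm
  obtain ⟨i, hi⟩ := exists_forall_lt_of_range hκ ((mk_subtype_le _).trans_lt hw) b
  refine ⟨e (i, f α i), ⟨i, rfl⟩, ?_⟩
  simp only [mem_iUnion, not_exists]
  rintro β ⟨hβ, hne⟩ ⟨j, hj⟩
  have := e.injective hj
  rw [Prod.mk.injEq] at this
  obtain ⟨rfl, h⟩ := this
  exact absurd (hb ⟨⟨β, hβ⟩, hne⟩ j h.symm) (hi _).not_gt

theorem HasUncoveredFamily.mono {μ θ σ σ₁ : Cardinal.{u}} (h : HasUncoveredFamily μ θ σ)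
    (hσ : σ₁ ≤ σ) : HasUncoveredFamily μ θ σ₁ :=
  let ⟨A, hA⟩ := h
  ⟨A, fun w hw => hA w (hw.trans_le hσ)⟩

end Uncovered

/-! ### Counting small sets -/

section Counting

variable {l : Cardinal.{u}}

theorem mk_arrow_le_of_powerlt (hpow : l ^< l = l) {α β : Type u}
    (hα : #α < l) (hβ : #β ≤ l) : #(α → β) ≤ l := by
  rw [← Cardinal.power_def]
  exact (Cardinal.power_le_power_right hβ).trans ((le_powerlt l hα).trans hpow.le)

/-- By regularity a small set is the range of a partial function on a proper initial segment of `l`,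
and `l^{<l} = l` counts these. -/
theorem mk_small_subsets_le (hl : l.IsRegular) (hpow : l ^< l = l) {α : Type u} (hα : #α ≤ l) :
    #{s : Set α // #s < l} ≤ l := by
  classical
  let F : (Σ i : Below l, Iio i → Option α) → Set α := fun x => {a | ∃ j, x.2 j = some a}
  have hF : ∀ s : {s : Set α // #s < l}, ∃ x, F x = s.1 := by
    rintro ⟨s, hs⟩
    obtain ⟨e⟩ : Nonempty (s ↪ Below l) := by
      rw [← Cardinal.le_def, mk_ord_toType]; exact hs.le
    obtain ⟨i, hi⟩ := exists_forall_lt_of_range hl hs e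
    refine ⟨⟨i, fun j => if h : ∃ a, e a = j.1 then some h.choose.1 else none⟩, ?_⟩
    ext a
    constructor
    · rintro ⟨j, hj⟩
      by_cases h : ∃ a, e a = j.1
      · simp only [dif_pos h, Option.some.injEq] at hj
        rw [← hj]; exact h.choose.2
      · simp only [dif_neg h, reduceCtorEq] at hj
    · intro ha
      have h : ∃ a', e a' = e ⟨a, ha⟩ := ⟨_, rfl⟩
      refine ⟨⟨e ⟨a, ha⟩, hi _⟩, ?_⟩
      simp only [dif_pos h, Option.some.injEq]
      rw [e.injective h.choose_spec]
  choose G hG using hF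
  have hinj : Function.Injective G := fun s t hst => Subtype.ext (by rw [← hG s, ← hG t, hst])
  refine (mk_le_of_injective hinj).trans ?_
  rw [mk_sigma]
  refine (sum_le_mk_mul_iSup _).trans (mul_le_of_le hl.aleph0_le (mk_ord_toType l).le
    (ciSup_le' fun i => mk_arrow_le_of_powerlt hpow (mk_Iio_below_lt i) ?_))
  rw [mk_option]
  exact add_le_of_le hl.aleph0_le hα (one_le_aleph0.trans hl.aleph0_le)

end Counting

/-! ### The colouring of finite sequences below a successor cardinal -/

section Colouring

variable {l : Cardinal.{u}}

/-- The sequences `b a` for `a ∈ s` differ already below `N`. -/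
def Separates (b : Below (Order.succ l) → Below l → Bool) (N : Below l)
    (s : Set (Below (Order.succ l))) : Prop :=
  ∀ a ∈ s, ∀ c ∈ s, (∀ m < N, b a m = b c m) → a = c

theorem Separates.mono {b : Below (Order.succ l) → Below l → Bool} {N M : Below l}
    {s t : Set (Below (Order.succ l))} (h : Separates b N s) (hNM : N ≤ M) (hts : t ⊆ s) :
    Separates b M t :=
  fun a ha c hc hac => h a (hts ha) c (hts hc) fun m hm => hac m (hm.trans_le hNM)

theorem exists_separates (hl : l.IsRegular) {b : Below (Order.succ l) → Below l → Bool}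
    (hb : Function.Injective b) {s : Set (Below (Order.succ l))} (hs : #s < l) :
    ∃ N, Separates b N s := by
  have hne : ∀ p : {p : s × s // p.1 ≠ p.2}, ∃ m, b p.1.1 m ≠ b p.1.2 m := fun p => by
    by_contra! h
    exact p.2 (Subtype.ext (hb (funext h)))
  choose m hm using hne
  obtain ⟨N, hN⟩ := exists_forall_lt_of_range hl (f := m) (by
    refine (mk_subtype_le _).trans_lt ?_
    rw [mk_prod, lift_id]
    exact mul_lt_of_lt hl.aleph0_le hs hs)
  refine ⟨N, fun a ha c hc hac => ?_⟩
  by_contra hne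
  let p : {p : s × s // p.1 ≠ p.2} := ⟨(⟨a, ha⟩, ⟨c, hc⟩), fun h => hne (congrArg Subtype.val h)⟩
  exact hm p (hac _ (hN p))

variable (b : Below (Order.succ l) → Below l → Bool)
  (r : Below (Order.succ l) → Below (Order.succ l) → Below l)

open Classical in
/-- `p` is the first point of a walk from the largest entry of `η` towards some entry of `η` at
which the rank of the next step separates the entries of `η`. -/
def IsCritical (η : List (Below (Order.succ l))) (p : Below (Order.succ l)) : Prop :=
  ∃ x ∈ η, (∀ z ∈ η, z ≤ x) ∧ ∃ y ∈ η,
    (walk r x y).find? (fun q => decide (Separates b (r q (step r q y)) {a | a ∈ η})) = some p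

open Classical in
/-- The colour of `η` is the `h`-value of its critical point. -/
noncomputable def criticalColour (h : Below (Order.succ l) → Below (Order.succ l))
    (c₀ : Below (Order.succ l)) (η : List (Below (Order.succ l))) : Below (Order.succ l) :=
  if hp : ∃ p, IsCritical b r η p then h hp.choose else c₀

variable {b r}

theorem criticalColour_eq {h : Below (Order.succ l) → Below (Order.succ l)}
    {c₀ : Below (Order.succ l)} {η : List (Below (Order.succ l))} {p : Below (Order.succ l)}
    (hp : IsCritical b r η p) (hu : ∀ q, IsCritical b r η q → q = p) :
    criticalColour b r h c₀ η = h p := by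
  have hex : ∃ p, IsCritical b r η p := ⟨p, hp⟩
  rw [criticalColour, dif_pos hex, hu _ hex.choose_spec]

/-- Stationarily many points of a club have the same small entries in their associated sets. -/
theorem exists_stat_root (hl : l.IsRegular) (hpow : l ^< l = l)
    {E : Set (Below (Order.succ l))} (hE : IsClub E)
    (L : Below (Order.succ l) → Set (Below (Order.succ l))) (hL : ∀ α, #(L α) < l) :
    ∃ Γ : Set (Below (Order.succ l)), Stat Γ ∧ Γ ⊆ E ∧
      ∀ α ∈ Γ, ∀ α' ∈ Γ, ∀ a ∈ L α, a < α → a ∈ L α' := by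
  have hl₀ := hl.aleph0_le
  obtain ⟨f, hf⟩ := exists_closure_points_mem_club hl₀ hE
  obtain ⟨b₀⟩ := nonempty_below_succ hl₀
  have h₀ := ((stat_cofPoints hl).inter_closed f).inter_gt b₀
  obtain ⟨g, h₁⟩ := h₀.exists_fiber_of_regressive hl₀
    (fun g α => ∀ a ∈ L α, a < α → a < g) (by
      rintro δ ⟨⟨hδ, -⟩, -⟩
      obtain ⟨g, hg, h⟩ := hδ {a ∈ L δ | a < δ} (fun a ha => ha.2)
        ((mk_le_mk_of_subset (sep_subset _ _)).trans_lt (hL δ))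
      exact ⟨g, hg, fun a ha ha' => h a ⟨ha, ha'⟩⟩)
  obtain ⟨s, h₂⟩ := h₁.exists_fiber hl₀ (mk_small_subsets_le hl hpow (mk_Iio_succ_le g))
    (fun s α => ∀ a : Iio g, a ∈ s.1 ↔ a.1 ∈ L α) (fun δ _ => by
      refine ⟨⟨{a | a.1 ∈ L δ}, ?_⟩, fun a => Iff.rfl⟩
      exact (mk_preimage_of_injective _ _ Subtype.val_injective).trans_lt (hL δ))
  refine ⟨_, h₂, ?_, ?_⟩
  · rintro δ ⟨⟨⟨⟨-, h⟩, hb⟩, -⟩, -⟩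
    exact hf δ ⟨_, hb⟩ h
  · rintro α ⟨⟨-, hα⟩, hαs⟩ α' ⟨-, hα's⟩ a ha hlt
    exact (hα's ⟨a, hα a ha hlt⟩).1 ((hαs ⟨a, hα a ha hlt⟩).2 ha)

/-- Below `N`, the sequence of `α` is that of `α₀`, and those of the members of `L α` are pairwise
different and occur among those of the members of `L α₀`. -/
def SameType (b : Below (Order.succ l) → Below l → Bool)
    (L : Below (Order.succ l) → Set (Below (Order.succ l))) (N : Below l)
    (α₀ α : Below (Order.succ l)) : Prop :=
  (∀ m < N, b α m = b α₀ m) ∧ Separates b N (L α) ∧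
    ∀ a ∈ L α, ∃ a₀ ∈ L α₀, ∀ m < N, b a m = b a₀ m

/-- All but boundedly many points of `Γ` have, at every level, cofinally many points of the same
type; a single function dominates their distribution. -/
theorem exists_type_bound (hl : l.IsRegular) (hpow : l ^< l = l)
    (b : Below (Order.succ l) → Below l → Bool)
    (L : Below (Order.succ l) → Set (Below (Order.succ l))) (hL : ∀ α, #(L α) < l)
    (Γ : Set (Below (Order.succ l))) :
    ∃ (B : Below (Order.succ l)) (F : Below (Order.succ l) → Below (Order.succ l)),
      ∀ α₀ ∈ Γ, B < α₀ → ∀ N, Separates b N (L α₀) →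
        ∀ a, ∃ α ∈ Γ, a < α ∧ α < F a ∧ SameType b L N α₀ α := by
  have hl₀ := hl.aleph0_le
  -- A type records a level, the restriction of `b α` to it, and the set of restrictions for `L α`.
  -- There are at most `l` types, so one `B` bounds all types whose realizations are bounded.
  let τ := Σ N : Below l, (Iio N → Bool) × {s : Set (Iio N → Bool) // #s < l}
  have hstr : ∀ N : Below l, #(Iio N → Bool) ≤ l := fun N => by
    have h2 : #(ULift.{u} Bool) ≤ l := by
      simpa using (natCast_lt_aleph0 (n := 2)).le.trans hl₀
    have := mk_arrow_le_of_powerlt hpow (mk_Iio_below_lt N) h2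
    refine le_trans (mk_le_of_injective (f := fun g i => ULift.up (g i)) ?_) this
    intro g g' h
    funext i
    exact ULift.up_injective (congrFun h i)
  have hτ : #τ ≤ l := by
    rw [mk_sigma]
    refine (sum_le_mk_mul_iSup _).trans (mul_le_of_le hl₀ (mk_ord_toType l).le
      (ciSup_le' fun N => ?_))
    rw [mk_prod, lift_id, lift_id]
    exact mul_le_of_le hl₀ (hstr N) (mk_small_subsets_le hl hpow (hstr N))
  let P : τ → Below (Order.succ l) → Prop := fun t α =>
    α ∈ Γ ∧ Separates b t.1 (L α) ∧ (fun m : Iio t.1 => b α m.1) = t.2.1 ∧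
      (fun a (m : Iio t.1) => b a m.1) '' L α = t.2.2.1
  have hbd : ∀ t, ∃ B, (∃ α, B < α ∧ P t α) → ∀ a, ∃ α, a < α ∧ P t α := fun t => by
    by_cases h : ∀ a, ∃ α, a < α ∧ P t α
    · obtain ⟨b₀⟩ := nonempty_below_succ hl₀
      exact ⟨b₀, fun _ => h⟩
    · push Not at h
      obtain ⟨B, hB⟩ := h
      exact ⟨B, fun ⟨α, h₁, h₂⟩ => absurd h₂ (hB α h₁)⟩
  choose B' hB' using hbd
  obtain ⟨B, hB⟩ := exists_strict_bound hl₀ hτ B'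
  have hF : ∀ t a, ∃ c, (∃ α, a < α ∧ P t α) → ∃ α, a < α ∧ α ≤ c ∧ P t α := fun t a => by
    by_cases h : ∃ α, a < α ∧ P t α
    · obtain ⟨α, h₁, h₂⟩ := h
      exact ⟨α, fun _ => ⟨α, h₁, le_rfl, h₂⟩⟩
    · exact ⟨a, fun h' => absurd h' h⟩
  choose F' hF' using hF
  obtain ⟨F, hFd⟩ := exists_dominating hl₀ hτ F'
  refine ⟨B, F, fun α₀ hα₀ hBα N hN a => ?_⟩
  let t : τ := ⟨N, fun m => b α₀ m.1, ⟨(fun a (m : Iio N) => b a m.1) '' L α₀,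
    mk_image_le.trans_lt (hL α₀)⟩⟩
  have hP : P t α₀ := ⟨hα₀, hN, rfl, rfl⟩
  obtain ⟨α, h₁, h₂, hαΓ, hsep, hα, hαL⟩ := hF' t a (hB' t ⟨α₀, (hB t).trans hBα, hP⟩ a)
  refine ⟨α, hαΓ, h₁, h₂.trans_lt (hFd t a), fun m hm => congrFun hα ⟨m, hm⟩, hsep,
    fun a' ha' => ?_⟩
  have hmem : (fun m : Iio N => b a' m.1) ∈ (fun a (m : Iio N) => b a m.1) '' L α₀ := by
    have : (fun m : Iio N => b a' m.1) ∈ (fun a (m : Iio N) => b a m.1) '' L α := ⟨a', ha', rfl⟩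
    rwa [hαL] at this
  obtain ⟨a₀, ha₀, h⟩ := hmem
  exact ⟨a₀, ha₀, fun m hm => (congrFun h ⟨m, hm⟩).symm⟩

end Colouring

/-! ### The critical point of a concatenation -/

section Colouring

variable {l : Cardinal.{u}} {b : Below (Order.succ l) → Below l → Bool}
  {r : Below (Order.succ l) → Below (Order.succ l) → Below l}

theorem mk_mem_list_lt {α : Type u} (η : List α) {κ : Cardinal.{u}} (hκ : ℵ₀ ≤ κ) :
    #{a | a ∈ η} < κ :=
  (lt_aleph0_iff_set_finite.2 (List.finite_toSet η)).trans_le hκ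

theorem mk_biUnion_lists_lt {α β : Type u} {σ : Cardinal.{u}} (hσ : ℵ₀ ≤ σ) {s : Set α}
    (hs : #s < σ) (f : α → List β) : #(⋃ a ∈ s, {b | b ∈ f a} : Set β) < σ := by
  rcases lt_or_ge #s ℵ₀ with h | h
  · refine lt_of_lt_of_le ?_ hσ
    rw [lt_aleph0_iff_set_finite] at h ⊢
    exact h.biUnion fun a _ => List.finite_toSet _
  · refine lt_of_le_of_lt ((mk_biUnion_le _ _).trans ?_) hs
    exact mul_le_of_le h le_rfl (ciSup_le' fun a => (mk_mem_list_lt _ le_rfl).le.trans h)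

/-- If `N` separates the entries attached to `α` and to `β`, up to `N` the point `β` looks like
`α`, and all walks concerned split at `δ`, then `δ` is the critical point of `ν ⌢ ρ`. -/
theorem isCritical_append_iff {Lα Lβ : Set (Below (Order.succ l))} {α β δ : Below (Order.succ l)}
    {n N : Below l} {η : List (Below (Order.succ l))}
    (hη : ∀ a ∈ η, a ∈ Lα ∨ a ∈ Lβ) (hαη : α ∈ η) (hβη : β ∈ η) (hαL : α ∈ Lα)
    (hαβ : ∀ m < n, b α m = b β m) (hsep : Separates b N (Lα ∪ Lβ))
    (hLα : ∀ a ∈ Lα, a ∉ Lβ → α ≤ a) (hLαδ : ∀ a ∈ Lα, a < δ) (hδβ : δ < β)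
    (hidx : ∀ x ∈ Lβ, ∀ y ∈ Lβ, ∀ p ∈ walk r x y, r p (step r p y) < n)
    (hidxδ : ∀ x ∈ Lβ, ∀ p ∈ walk r x δ, r p (step r p δ) < n)
    (hwalk : ∀ y, α ≤ y → y < δ → ∀ x ∈ Lβ, δ ≤ x → walk r x y = walk r x δ ++ walk r δ y ∧
      ∀ p ∈ walk r x δ, step r p y = step r p δ)
    (hN : ∀ y, α ≤ y → y < δ → N ≤ r δ (step r δ y)) (p : Below (Order.succ l)) :
    IsCritical b r η p ↔ p = δ := by
  classical
  -- Both `α` and `β` are entries of `η` and agree below `n`, so ranks under `n` never separate `η`.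
  have hnot : ∀ i < n, ¬ Separates b i {a | a ∈ η} := fun i hi h =>
    absurd (h α hαη β hβη fun m hm => hαβ m (hm.trans hi)) ((hLαδ α hαL).trans hδβ).ne
  have hx : ∀ x ∈ η, (∀ z ∈ η, z ≤ x) → x ∈ Lβ ∧ δ ≤ x := fun x hxη hmax => by
    have hδx := hδβ.trans_le (hmax β hβη)
    exact ⟨(hη x hxη).resolve_left fun h => absurd (hLαδ x h) hδx.not_gt, hδx.le⟩
  have hfind : ∀ x ∈ Lβ, δ ≤ x → ∀ y, α ≤ y → y < δ → (walk r x y).find?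
      (fun q => decide (Separates b (r q (step r q y)) {a | a ∈ η})) = some δ := by
    intro x hxL hδx y hαy hyδ
    obtain ⟨e₁, e₂⟩ := hwalk y hαy hyδ x hxL hδx
    have hnone : (walk r x δ).find?
        (fun q => decide (Separates b (r q (step r q y)) {a | a ∈ η})) = none := by
      rw [List.find?_eq_none]
      intro q hq
      rw [e₂ q hq, decide_eq_true_eq]
      exact hnot _ (hidxδ x hxL q hq)
    have hsepδ : Separates b (r δ (step r δ y)) {a | a ∈ η} :=
      hsep.mono (hN y hαy hyδ) fun a ha => hη a ha
    rw [e₁, List.find?_append, hnone, walk_of_lt hyδ, List.find?_cons_of_pos (by simpa using hsepδ),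
      Option.none_or]
  constructor
  · rintro ⟨x, hxη, hmax, y, hyη, hp⟩
    obtain ⟨hxL, hδx⟩ := hx x hxη hmax
    by_cases hy : y ∈ Lβ
    · have h₁ := List.find?_some hp
      rw [decide_eq_true_eq] at h₁
      exact absurd h₁ (hnot _ (hidx x hxL y hy p (List.mem_of_find?_eq_some hp)))
    · have hyα := (hη y hyη).resolve_right hy
      rw [hfind x hxL hδx y (hLα y hyα hy) (hLαδ y hyα)] at hp
      exact (Option.some.inj hp).symm
  · rintro rfl
    obtain ⟨x, hxη, hmax⟩ := Finset.exists_max_image η.toFinset id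
      ⟨α, List.mem_toFinset.2 hαη⟩
    have hxη' := List.mem_toFinset.1 hxη
    have hmax' : ∀ z ∈ η, z ≤ x := fun z hz => hmax z (List.mem_toFinset.2 hz)
    obtain ⟨hxL, hδx⟩ := hx x hxη' hmax'
    exact ⟨x, hxη', hmax', α, hαη, hfind x hxL hδx α le_rfl (hLαδ α hαL)⟩

theorem realizes_criticalColour (hl : l.IsRegular) (hpow : l ^< l = l)
    (hb : Function.Injective b) (hr : ∀ x, InjOn (r x) (Iio x))
    {h : Below (Order.succ l) → Below (Order.succ l)}
    (hh : ∀ c, Stat {δ ∈ cofPoints l | h δ = c}) (c₀ : Below (Order.succ l)) :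
    Realizes (criticalColour b r h c₀) l {E | IsClub E} := by
  intro u v huv hmem γ E hE
  have hl₀ := hl.aleph0_le
  let L : Below (Order.succ l) → Set (Below (Order.succ l)) := fun α =>
    insert α (⋃ ν ∈ u α ∪ v α, {a | a ∈ ν})
  have hL : ∀ α, #(L α) < l := fun α => by
    refine mk_insert_le.trans_lt (add_lt_of_lt hl₀ ?_ (one_lt_aleph0.trans_le hl₀))
    exact mk_biUnion_lists_lt hl₀ (huv α) fun ν => ν
  have hαL : ∀ α, α ∈ L α := fun α => mem_insert _ _
  have hsub : ∀ α, ∀ ν ∈ u α ∪ v α, ∀ a ∈ ν, a ∈ L α := fun α ν hν a ha =>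
    mem_insert_of_mem _ (mem_biUnion hν ha)
  obtain ⟨Γ, hΓ, hΓE, hroot⟩ := exists_stat_root hl hpow hE L hL
  obtain ⟨B, F, hBF⟩ := exists_type_bound hl hpow b L hL Γ
  choose top htop using fun α => exists_strict_bound hl₀ (hL α).le (fun a : L α => a.1)
  obtain ⟨δ, ⟨hδ, hδγ⟩, -, hδF⟩ := hh γ (fun a => max (F a) (top a)) B
  obtain ⟨β, hβΓ, hβ⟩ := hΓ.exists_gt (max δ B)
  have hδβ := (le_max_left _ _).trans_lt hβ
  obtain ⟨N₀, hN₀⟩ := exists_separates hl hb (hL β)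
  obtain ⟨n₁, hn₁⟩ := exists_forall_lt_of_mk_lt hl
    (s := ⋃ x ∈ L β, ⋃ y ∈ insert δ (L β), (fun p => r p (step r p y)) '' {p | p ∈ walk r x y}) (by
      rw [card_biUnion_lt_iff_forall_of_isRegular hl (hL β)]
      intro x _
      rw [card_biUnion_lt_iff_forall_of_isRegular hl
        (mk_insert_le.trans_lt (add_lt_of_lt hl₀ (hL β) (one_lt_aleph0.trans_le hl₀)))]
      exact fun y _ => mk_image_le.trans_lt (mk_mem_list_lt _ hl₀))
  have hidx : ∀ x ∈ L β, ∀ y ∈ insert δ (L β), ∀ p ∈ walk r x y,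
      r p (step r p y) < max N₀ n₁ := fun x hx y hy p hp =>
    (hn₁ _ (mem_biUnion hx (mem_biUnion hy ⟨p, hp, rfl⟩))).trans_le (le_max_right _ _)
  -- How close `α` must be to `δ` depends on a level `N` separating its entries from those of `β`.
  -- To fix `N` first, a proxy `α'` of the same type as `β` is taken beyond all entries of `L β`;
  -- afterwards `α < δ` copies `α'` up to `N`.
  obtain ⟨α', hα'Γ, hα'B, -, hα'⟩ := hBF β hβΓ ((le_max_right _ _).trans_lt hβ) (max N₀ n₁)
    (hN₀.mono (le_max_left _ _) subset_rfl) (max B (top β))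
  obtain ⟨N₂, hN₂⟩ := exists_separates hl hb (s := L α' ∪ L β)
    ((mk_union_le _ _).trans_lt (add_lt_of_lt hl₀ (hL α') (hL β)))
  have hN : Separates b (max N₂ (max N₀ n₁)) (L α' ∪ L β) := hN₂.mono (le_max_left _ _) subset_rfl
  obtain ⟨t₁, ht₁, hwalk⟩ := exists_forall_walk_eq_append hr hδ (s := {x ∈ L β | δ ≤ x})
    ((mk_le_mk_of_subset (sep_subset _ _)).trans_lt (hL β)) (fun x hx => hx.2)
  obtain ⟨t₂, ht₂, hrank⟩ := exists_le_rank_step hr hδ (max N₂ (max N₀ n₁))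
  obtain ⟨α, hαΓ, hαt, hαF, hαb, hαsep, hαα'⟩ := hBF α' hα'Γ ((le_max_left _ _).trans_lt hα'B)
    (max N₂ (max N₀ n₁)) (hN.mono le_rfl subset_union_left) (max t₁ t₂)
  have hαδ : α < δ := hαF.trans ((le_max_left _ _).trans_lt (hδF _ (max_lt ht₁ ht₂)))
  have hsep : Separates b (max N₂ (max N₀ n₁)) (L α ∪ L β) := by
    -- If `a` and `c` look alike, the counterpart of `a` in `L α'` equals `c`. It is then below
    -- `α'`, so it belongs to the common root and to `L α`, where `a` is separated from it.
    have hmix : ∀ a ∈ L α, ∀ c ∈ L β, (∀ m < max N₂ (max N₀ n₁), b a m = b c m) → a = c := by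
      intro a ha c hc hac
      obtain ⟨a', ha', h'⟩ := hαα' a ha
      have : a' = c := hN a' (Or.inl ha') c (Or.inr hc) fun m hm => (h' m hm).symm.trans (hac m hm)
      subst this
      have hlt : a' < α' := (htop β ⟨a', hc⟩).trans ((le_max_right _ _).trans_lt hα'B)
      exact hαsep a ha a' (hroot α' hα'Γ α hαΓ a' ha' hlt) hac
    rintro a (ha | ha) c (hc | hc) hac
    · exact hαsep a ha c hc hac
    · exact hmix a ha c hc hac
    · exact (hmix c hc a ha fun m hm => (hac m hm).symm).symm
    · exact hN a (Or.inr ha) c (Or.inr hc) hac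
  refine ⟨α, hΓE hαΓ, β, hΓE hβΓ, hαδ.trans hδβ, fun ν hν ρ hρ => ?_⟩
  have hcrit := isCritical_append_iff (r := r) (η := ν ++ ρ) (n := max N₀ n₁) (Lα := L α)
    (Lβ := L β) (α := α) (β := β) (δ := δ)
    (fun a ha => (List.mem_append.1 ha).imp (hsub α ν (Or.inl hν) a) (hsub β ρ (Or.inr hρ) a))
    (List.mem_append_left _ (hmem α ν (Or.inl hν))) (List.mem_append_right _ (hmem β ρ (Or.inr hρ)))
    (hαL α)
    (fun m hm => (hαb m (hm.trans_le (le_max_right _ _))).trans (hα'.1 m hm)) hsep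
    (fun a ha haβ => by
      by_contra! hlt
      exact haβ (hroot α hαΓ β hβΓ a ha hlt))
    (fun a ha => (htop α ⟨a, ha⟩).trans
      ((le_max_right _ _).trans_lt (hδF α hαδ)))
    hδβ (fun x hx y hy => hidx x hx y (mem_insert_of_mem _ hy))
    (fun x hx => hidx x hx δ (mem_insert _ _))
    (fun y hy hyδ x hx hδx =>
      hwalk y ((le_max_left _ _).trans (hαt.le.trans hy)) hyδ x ⟨hx, hδx⟩)
    (fun y hy hyδ => hrank y ((le_max_right _ _).trans (hαt.le.trans hy)) hyδ)
  rw [criticalColour_eq ((hcrit δ).2 rfl) fun q hq => (hcrit q).1 hq, hδγ]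

theorem pr6_succ_of_powerlt (hl : l.IsRegular) (hpow : l ^< l = l) :
    Pr6 (Order.succ l) (Order.succ l) l := by
  obtain ⟨r, hr⟩ := exists_ranks hl.aleph0_le
  obtain ⟨h, hh⟩ := exists_stationary_partition hl
  obtain ⟨c₀⟩ := nonempty_below_succ hl.aleph0_le
  obtain ⟨b⟩ : Nonempty (Below (Order.succ l) ↪ (Below l → Bool)) := by
    rw [← lift_mk_le']
    simpa using Order.succ_le_of_lt (cantor l)
  exact ⟨_, realizes_criticalColour hl hpow b.injective hr hh c₀⟩

end Colouring

/-! ### Stepping up: colouring pairs below `κ⁺` along walks -/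

section SteppingUp

variable {κ κ' θ σ : Cardinal.{u}}
  {r : Below (Order.succ κ) → Below (Order.succ κ) → Below κ}

theorem exists_forall_le_of_disjoint
    {u : Below (Order.succ κ) → Set (Below (Order.succ κ))}
    (hu : ∀ α β, α < β → Disjoint (u α) (u β)) (b : Below (Order.succ κ)) :
    ∃ α, ∀ ξ ∈ u α, b ≤ ξ := by
  by_contra! h
  choose f hf hfb using h
  have hinj : Function.Injective fun α => (⟨f α, hfb α⟩ : Iio b) := by
    intro α β hαβ
    have he : f α = f β := congrArg Subtype.val hαβ
    by_contra hne
    rcases lt_or_gt_of_ne hne with hlt | hlt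
    · exact disjoint_left.1 (hu _ _ hlt) (hf α) (he ▸ hf β)
    · exact disjoint_left.1 (hu _ _ hlt) (hf β) (he ▸ hf α)
  have := mk_le_of_injective hinj
  rw [mk_ord_toType] at this
  exact absurd (mk_Iio_below_lt b) this.not_gt

variable (r) in
/-- The pair `ζ < ξ` receives the colour selected on the walk from `ξ` to `ζ` by the `d`-value of
the sequence of letters of the walk. -/
noncomputable def walkColour (h : Below (Order.succ κ) → Below κ') (d : List (Below κ') → Below θ)
    (pick : Below θ → List (Below (Order.succ κ)) → Below (Order.succ κ))
    (ζ ξ : Below (Order.succ κ)) : Below (Order.succ κ) :=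
  pick (d ((walk r (max ζ ξ) (min ζ ξ)).map h)) (walk r (max ζ ξ) (min ζ ξ))

/-- Below a suitable point `δ` of cofinality `κ`, arbitrarily close to `δ` there are members of the
family such that all walks from `δ` to them use a given letter. -/
theorem exists_lower_members (hκ : κ.IsRegular) (hκ' : κ' ≤ κ) (hr : ∀ x, InjOn (r x) (Iio x))
    {h : Below (Order.succ κ) → Below κ'} (hh : ∀ i, Stat {δ ∈ cofPoints κ | h δ = i})
    {u : Below (Order.succ κ) → Set (Below (Order.succ κ))} (hucard : ∀ α, #(u α) ≤ κ)
    (hu : ∀ α β, α < β → Disjoint (u α) (u β)) (g : Below (Order.succ κ)) :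
    ∃ δ ∈ cofPoints κ, g < δ ∧ ∀ j, ∀ a < δ, ∃ e, ∀ ζ ∈ u e, a ≤ ζ ∧ ζ < δ ∧
      j ∈ (walk r δ ζ).map h := by
  have hκ₀ := hκ.aleph0_le
  choose x hx using exists_forall_le_of_disjoint hu
  choose top htop using fun b => exists_strict_bound hκ₀ (hucard (x b)) (fun a => a.1)
  choose τ hτ hτb hτtop using fun (j : Below κ') b => hh j top b
  obtain ⟨δ, hδ, hgδ, hδτ⟩ := (stat_cofPoints hκ).exists_closed hκ₀
    ((mk_ord_toType κ').le.trans hκ') τ g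
  refine ⟨δ, hδ, hgδ, fun j a ha => ?_⟩
  have hτδ := hδτ j a ha
  obtain ⟨t, ht, hwalk⟩ := exists_walk_eq_append hr (hτ j a).1 δ hτδ.le
  refine ⟨x (max a t), fun ζ hζ => ?_⟩
  have hζ₁ := hx _ ζ hζ
  have hζτ : ζ < τ j a := (htop _ ⟨ζ, hζ⟩).trans (hτtop j a _ (max_lt (hτb j a) ht))
  refine ⟨(le_max_left _ _).trans hζ₁, hζτ.trans hτδ, ?_⟩
  rw [(hwalk ζ ((le_max_right _ _).trans hζ₁) hζτ).1]
  exact List.mem_map.2 ⟨τ j a, List.mem_append_right _ (mem_walk_self hζτ), (hτ j a).2⟩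

/-- At a suitable `δ`, upper halves of walks using the letter `i` and lower halves using the letter
`j` supply the sets to which `d` is applied; the resulting `γ` makes `pick` return `c`. -/
theorem exists_pair_of_upper_members (hκ : κ.IsRegular) (hκ'r : κ'.IsRegular) (hκ' : κ' ≤ κ)
    (hσ₀ : ℵ₀ ≤ σ) (hσ : σ ≤ κ) (hr : ∀ x, InjOn (r x) (Iio x))
    {h : Below (Order.succ κ) → Below κ'} (hh : ∀ i, Stat {δ ∈ cofPoints κ | h δ = i})
    {d : List (Below κ') → Below θ} (hd : Realizes d σ {Set.univ})
    {pick : Below θ → List (Below (Order.succ κ)) → Below (Order.succ κ)}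
    {u : Below (Order.succ κ) → Set (Below (Order.succ κ))} (hucard : ∀ α, #(u α) < σ)
    (hu : ∀ α β, α < β → Disjoint (u α) (u β)) {c : Below (Order.succ κ)}
    {γ : Below θ} {g : Below (Order.succ κ)}
    (hup : ∀ i, ∀ δ ∈ cofPoints κ, g < δ → ∃ a, ∀ ξ ∈ u a, δ ≤ ξ ∧ i ∈ (walk r ξ δ).map h ∧
      ∀ w, pick γ (walk r ξ δ ++ w) = c) :
    ∃ α β, α < β ∧ ∀ ζ ∈ u α, ∀ ξ ∈ u β, walkColour r h d pick ζ ξ = c := by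
  obtain ⟨δ, hδ, hgδ, hlow⟩ := exists_lower_members hκ hκ' hr hh
    (fun α => ((hucard α).trans_le hσ).le) hu g
  choose a ha using fun i => hup i δ hδ hgδ
  choose s hs hwalk using fun i => exists_forall_walk_eq_append hr hδ
    ((hucard (a i)).trans_le hσ) (fun ξ hξ => (ha i ξ hξ).1)
  -- The bound `s' j` covers all `s i` with `i ≤ j`; hence for `i < j` the walks from `u (a i)` to
  -- `u (e j)` split at `δ`.
  choose s' hs' hss' using fun j => cofPoints_exists_bound hδ
    ((mk_Iic_below_lt hκ'r j).trans_le hκ') (fun i : Iic j => s i.1) (fun i => hs i.1)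
  choose e he using fun j => hlow j (s' j) (hs' j)
  obtain ⟨i, -, j, -, hij, hcol⟩ := hd
    (fun i => (fun ξ => (walk r ξ δ).map h) '' u (a i))
    (fun j => (fun ζ => (walk r δ ζ).map h) '' u (e j))
    (fun i => (mk_union_le _ _).trans_lt (add_lt_of_lt hσ₀ (mk_image_le.trans_lt (hucard _))
      (mk_image_le.trans_lt (hucard _))))
    (by
      rintro i _ (⟨ξ, hξ, rfl⟩ | ⟨ζ, hζ, rfl⟩)
      · exact (ha i ξ hξ).2.1
      · exact (he i ζ hζ).2.2)
    γ Set.univ rfl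
  have key : ∀ ζ ∈ u (e j), ∀ ξ ∈ u (a i), ζ < ξ ∧
      pick (d ((walk r ξ ζ).map h)) (walk r ξ ζ) = c := by
    intro ζ hζ ξ hξ
    have h₁ := ha i ξ hξ
    have h₂ := he j ζ hζ
    refine ⟨h₂.2.1.trans_le h₁.1, ?_⟩
    have hw := (hwalk i ζ ((hss' j ⟨i, hij.le⟩).le.trans h₂.1) h₂.2.1 ξ hξ).1
    rw [hw, List.map_append, hcol _ ⟨ξ, hξ, rfl⟩ _ ⟨ζ, hζ, rfl⟩, h₁.2.2]
  rcases lt_trichotomy (e j) (a i) with hlt | heq | hlt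
  · refine ⟨e j, a i, hlt, fun ζ hζ ξ hξ => ?_⟩
    obtain ⟨hlt', hk⟩ := key ζ hζ ξ hξ
    rw [walkColour, max_eq_right hlt'.le, min_eq_left hlt'.le, hk]
  -- Equal indices force `u (a i)` to be empty, since its members would lie below themselves; any
  -- larger index then works.
  · obtain ⟨β, hβ⟩ := exists_below_gt (isRegular_succ hκ.aleph0_le) (a i)
    refine ⟨a i, β, hβ, fun ζ hζ => ?_⟩
    exact absurd (key ζ (heq ▸ hζ) ζ hζ).1 (lt_irrefl _)
  · refine ⟨a i, e j, hlt, fun ξ hξ ζ hζ => ?_⟩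
    obtain ⟨hlt', hk⟩ := key ζ hζ ξ hξ
    rw [walkColour, max_eq_left hlt'.le, min_eq_right hlt'.le, hk]

/-- It suffices to select the colour `c` at stationarily many points `p`, uniformly on the walks
through `p` from a member of the family above `p`. -/
theorem exists_pair_of_stat (hκ : κ.IsRegular) (hκ'r : κ'.IsRegular) (hκ' : κ' ≤ κ)
    (hσ₀ : ℵ₀ ≤ σ) (hσ : σ ≤ κ) (hr : ∀ x, InjOn (r x) (Iio x))
    {h : Below (Order.succ κ) → Below κ'} (hh : ∀ i, Stat {δ ∈ cofPoints κ | h δ = i})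
    {d : List (Below κ') → Below θ} (hd : Realizes d σ {Set.univ})
    {pick : Below θ → List (Below (Order.succ κ)) → Below (Order.succ κ)}
    {u : Below (Order.succ κ) → Set (Below (Order.succ κ))} (hucard : ∀ α, #(u α) < σ)
    (hu : ∀ α β, α < β → Disjoint (u α) (u β)) {c : Below (Order.succ κ)}
    {γ : Below θ} {t : Below (Order.succ κ)} {A : Set (Below (Order.succ κ))} (hA : Stat A)
    (hpick : ∀ p ∈ A, ∃ a, ∀ ξ ∈ u a, p ≤ ξ ∧
      (∀ α, t ≤ α → α < p → walk r ξ α = walk r ξ p ++ walk r p α) ∧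
      ∀ w, pick γ (walk r ξ p ++ p :: w) = c) :
    ∃ α β, α < β ∧ ∀ ζ ∈ u α, ∀ ξ ∈ u β, walkColour r h d pick ζ ξ = c := by
  have hκ₀ := hκ.aleph0_le
  choose p hpA hp using fun δ => hA.exists_gt δ
  -- A point `τ` of letter `i` is to be inserted below `p τ ∈ A`, so that walks from `ξ` to `δ` pass
  -- through `p τ` and then `τ`. Fodor's lemma makes the threshold depend on `i` only.
  have hfodor : ∀ i, ∃ s, Stat {δ ∈ {δ ∈ cofPoints κ | h δ = i} |
      ∀ α, s ≤ α → α < δ → walk r (p δ) α = walk r (p δ) δ ++ walk r δ α} := fun i =>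
    (hh i).exists_fiber_of_regressive hκ₀ _ (by
      rintro δ ⟨hδ, -⟩
      obtain ⟨s, hs, hw⟩ := exists_walk_eq_append hr hδ (p δ) (hp δ).le
      exact ⟨s, hs, fun α h₁ h₂ => (hw α h₁ h₂).1⟩)
  choose s hs using hfodor
  obtain ⟨g, hg⟩ := exists_strict_bound hκ₀ ((mk_ord_toType κ').le.trans hκ') s
  refine exists_pair_of_upper_members hκ hκ'r hκ' hσ₀ hσ hr hh hd hucard hu (γ := γ)
    (g := max g t) fun i δ _ hgδ => ?_
  obtain ⟨τ, ⟨⟨-, hτi⟩, hτ⟩, hδτ⟩ := (hs i).exists_gt δ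
  obtain ⟨a, ha⟩ := hpick (p τ) (hpA τ)
  refine ⟨a, fun ξ hξ => ?_⟩
  obtain ⟨h₁, h₂, h₃⟩ := ha ξ hξ
  have hδp := hδτ.trans (hp τ)
  have hw := h₂ δ ((le_max_right _ _).trans hgδ.le) hδp
  refine ⟨hδp.le.trans h₁, ?_, fun w => ?_⟩
  · rw [hw, hτ δ ((hg i).le.trans ((le_max_left _ _).trans hgδ.le)) hδτ]
    exact List.mem_map.2 ⟨τ, List.mem_append_right _ (List.mem_append_right _
      (mem_walk_self hδτ)), hτi⟩
  · rw [hw, walk_of_lt hδp, List.append_assoc, List.cons_append, h₃]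

end SteppingUp

/-! ### Selection rules on walks and the resulting colourings of pairs -/

section SteppingUp

variable {κ κ' θ σ : Cardinal.{u}}

theorem exists_two_stationary_partitions (hκ : κ.IsRegular) (hκ'₀ : κ' ≠ 0) (hκ' : κ' ≤ κ) :
    ∃ (h : Below (Order.succ κ) → Below κ') (h' : Below (Order.succ κ) → Below (Order.succ κ)),
      ∀ i c, Stat {δ ∈ cofPoints κ | h δ = i ∧ h' δ = c} := by
  obtain ⟨f, hf⟩ := exists_stationary_partition hκ
  obtain ⟨e⟩ : Nonempty (Below (Order.succ κ) ≃ Below (Order.succ κ) × Below κ') := by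
    rw [← Cardinal.eq]
    simp only [mk_prod, lift_id, mk_ord_toType]
    exact (mul_eq_left (hκ.aleph0_le.trans (Order.le_succ κ)) (hκ'.trans (Order.le_succ κ))
      hκ'₀).symm
  refine ⟨fun δ => (e (f δ)).2, fun δ => (e (f δ)).1, fun i c => (hf (e.symm (c, i))).mono ?_⟩
  rintro δ ⟨hδ, h⟩
  refine ⟨hδ, ?_, ?_⟩ <;> simp [h]

theorem walkColour_comm (r : Below (Order.succ κ) → Below (Order.succ κ) → Below κ)
    (h : Below (Order.succ κ) → Below κ') (d : List (Below κ') → Below θ)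
    (pick : Below θ → List (Below (Order.succ κ)) → Below (Order.succ κ))
    (ζ ξ : Below (Order.succ κ)) : walkColour r h d pick ζ ξ = walkColour r h d pick ξ ζ := by
  rw [walkColour, walkColour, max_comm, min_comm]

theorem pr1_of_hasUncoveredFamily (hκ : κ.IsRegular) (hσ₀ : ℵ₀ ≤ σ) (hσ : σ ≤ κ) (hθ : θ ≤ κ)
    {d : List (Below κ) → Below θ} (hd : Realizes d σ {Set.univ})
    (hA : HasUncoveredFamily (Order.succ κ) θ σ) :
    Pr1 (Order.succ κ) (Order.succ κ) (Order.succ κ) σ := by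
  classical
  have hκ₀ := hκ.aleph0_le
  obtain ⟨A, hA⟩ := hA
  obtain ⟨r, hr⟩ := exists_ranks hκ₀
  obtain ⟨h, h', hh⟩ := exists_two_stationary_partitions hκ hκ.pos.ne' le_rfl
  obtain ⟨c₀⟩ := nonempty_below_succ hκ₀
  obtain ⟨i₀⟩ := nonempty_below hκ.pos.ne'
  refine ⟨walkColour r h d fun γ w => ((w.find? fun β => decide (γ ∈ A β)).map h').getD c₀,
    walkColour_comm r _ _ _, fun u hucard hu c => ?_⟩
  choose x hx using exists_forall_le_of_disjoint hu
  obtain ⟨t, ht⟩ := (hh i₀ c).exists_fiber_of_regressive hκ₀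
    (fun t p => ∀ α, t ≤ α → α < p → ∀ ξ ∈ u (x p), walk r ξ α = walk r ξ p ++ walk r p α) (by
      rintro p ⟨hp, -⟩
      obtain ⟨t, ht, hw⟩ := exists_forall_walk_eq_append hr hp ((hucard (x p)).trans_le hσ) (hx p)
      exact ⟨t, ht, fun α h₁ h₂ ξ hξ => (hw α h₁ h₂ ξ hξ).1⟩)
  -- The points visited before `p` number fewer than `σ`, so some `γ ∈ A p` avoids their sets and
  -- selects `p`; pigeonhole makes `γ` constant.
  obtain ⟨γ, hγ⟩ := ht.exists_fiber hκ₀ ((mk_ord_toType θ).le.trans hθ)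
    (fun γ p => γ ∈ A p ∧ ∀ ξ ∈ u (x p), ∀ β ∈ walk r ξ p, γ ∉ A β) (by
      intro p _
      have hlt : ∀ ξ ∈ u (x p), ∀ β ∈ walk r ξ p, β ≠ p := fun ξ _ β hβ => (lt_of_mem_walk hβ).ne'
      obtain ⟨γ, hγ, hγ'⟩ := hA (insert p (⋃ ξ ∈ u (x p), {β | β ∈ walk r ξ p})) (by
        refine mk_insert_le.trans_lt (add_lt_of_lt hσ₀ ?_ (one_lt_aleph0.trans_le hσ₀))
        exact mk_biUnion_lists_lt hσ₀ (hucard _) _) p (mem_insert _ _)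
      refine ⟨γ, hγ, fun ξ hξ β hβ hγβ => hγ' ?_⟩
      exact mem_biUnion ⟨mem_insert_of_mem _ (mem_biUnion hξ hβ), hlt ξ hξ β hβ⟩ hγβ)
  refine exists_pair_of_stat hκ hκ le_rfl hσ₀ hσ hr
    (fun i => (hh i c₀).mono fun δ hδ => ⟨hδ.1, hδ.2.1⟩) hd hucard hu (γ := γ) (t := t) hγ ?_
  rintro p ⟨⟨⟨-, -, hpc⟩, hw⟩, hγp, hγw⟩
  refine ⟨x p, fun ξ hξ => ⟨hx p ξ hξ, fun α h₁ h₂ => hw α h₁ h₂ ξ hξ, fun w => ?_⟩⟩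
  have hnone : (walk r ξ p).find? (fun β => decide (γ ∈ A β)) = none := by
    rw [List.find?_eq_none]
    intro β hβ
    simpa using hγw ξ hξ β hβ
  rw [List.find?_append, hnone, List.find?_cons_of_pos (by simpa using hγp)]
  simpa using hpc

/-- The strong colouring for finite sets holds at the successor of every regular uncountable
cardinal. -/
theorem pr1_aleph0 (hκ : κ.IsRegular) (hκ₁ : Order.succ ℵ₀ ≤ κ) :
    Pr1 (Order.succ κ) (Order.succ κ) (Order.succ κ) ℵ₀ := by
  classical
  have hκ₀ := hκ.aleph0_le
  have hω₁ : (Order.succ (ℵ₀ : Cardinal.{u})).IsRegular := isRegular_succ le_rfl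
  obtain ⟨d, hd⟩ := pr6_succ_of_powerlt (l := (ℵ₀ : Cardinal.{u})) isRegular_aleph0
    (powerlt_aleph0 le_rfl)
  obtain ⟨r, hr⟩ := exists_ranks hκ₀
  obtain ⟨h, h', hh⟩ := exists_two_stationary_partitions hκ hω₁.pos.ne' hκ₁
  obtain ⟨c₀⟩ := nonempty_below_succ hκ₀
  obtain ⟨i₀⟩ := nonempty_below hω₁.pos.ne'
  obtain ⟨e⟩ : Nonempty (Below (Order.succ (ℵ₀ : Cardinal.{u})) × ULift.{u} ℕ ≃
      Below (Order.succ (ℵ₀ : Cardinal.{u}))) := by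
    rw [← Cardinal.eq]
    simp only [mk_prod, lift_id, mk_ord_toType, mk_uLift, mk_nat, lift_aleph0]
    exact mul_eq_left (Order.le_succ _) (Order.le_succ _) aleph0_ne_zero
  -- Here `γ` codes a pair `(i, k)`, and the selected point lies `k` places after the first
  -- occurrence of the letter `i`.
  refine ⟨walkColour r h d fun γ w =>
    (w[(w.map h).idxOf (e.symm γ).1 + (e.symm γ).2.down]?.map h').getD c₀,
    walkColour_comm r _ _ _, fun u hucard hu c => ?_⟩
  choose x hx using exists_forall_le_of_disjoint hu
  obtain ⟨t, ht⟩ := (stat_cofPoints hκ).exists_fiber_of_regressive hκ₀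
    (fun t p => ∀ α, t ≤ α → α < p → ∀ ξ ∈ u (x p), walk r ξ α = walk r ξ p ++ walk r p α) (by
      rintro p hp
      obtain ⟨t, ht, hw⟩ := exists_forall_walk_eq_append hr hp ((hucard (x p)).trans_le hκ₀) (hx p)
      exact ⟨t, ht, fun α h₁ h₂ ξ hξ => (hw α h₁ h₂ ξ hξ).1⟩)
  -- Finitely many finite walks use only finitely many letters, so some letter below `ω₁` is missing
  -- above `p`.
  obtain ⟨i, hi⟩ := ht.exists_fiber hκ₀ ((mk_ord_toType (Order.succ ℵ₀)).le.trans hκ₁)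
    (fun i p => ∀ ξ ∈ u (x p), i ∉ (walk r ξ p).map h) (by
      intro p _
      obtain ⟨i, hi⟩ := exists_forall_lt_of_mk_lt hω₁
        (s := ⋃ ξ ∈ u (x p), {i | i ∈ (walk r ξ p).map h})
        ((mk_biUnion_lists_lt le_rfl (hucard _) _).trans (Order.lt_succ _))
      exact ⟨i, fun ξ hξ hmem => lt_irrefl i (hi i (mem_biUnion hξ hmem))⟩)
  choose q hqA hq using fun p => hi.exists_gt p
  obtain ⟨s, hs⟩ := ((hh i c).inter_gt t).exists_fiber_of_regressive hκ₀
    (fun s p => ∀ α, s ≤ α → α < p → walk r (q p) α = walk r (q p) p ++ walk r p α) (by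
      rintro p ⟨⟨hp, -⟩, -⟩
      obtain ⟨s, hs, hw⟩ := exists_walk_eq_append hr hp (q p) (hq p).le
      exact ⟨s, hs, fun α h₁ h₂ => (hw α h₁ h₂).1⟩)
  -- Since `p` itself has letter `i`, the first `i` after `q p` occurs no later than `p`; `k` is the
  -- remaining distance to `p`.
  obtain ⟨k, hk⟩ := hs.exists_fiber hκ₀ (ι := ULift.{u} ℕ) (by simpa using hκ₀)
    (fun k p => ((walk r (q p) p).map h ++ [h p]).idxOf i + k.down = (walk r (q p) p).length) (by
      rintro p ⟨⟨⟨-, hpi, -⟩, -⟩, -⟩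
      have hlt : ((walk r (q p) p).map h ++ [h p]).idxOf i <
          ((walk r (q p) p).map h ++ [h p]).length :=
        List.idxOf_lt_length_iff.2 (by simp [hpi])
      rw [List.length_append, List.length_map, List.length_singleton] at hlt
      exact ⟨⟨_⟩, Nat.add_sub_cancel' (Nat.lt_succ_iff.1 hlt)⟩)
  refine exists_pair_of_stat hκ hω₁ hκ₁ le_rfl hκ₀ hr
    (fun i => (hh i c₀).mono fun δ hδ => ⟨hδ.1, hδ.2.1⟩)
    (fun u v h₁ h₂ γ E hE => hd u v h₁ h₂ γ E (by rw [hE]; exact IsClub.univ))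
    hucard hu (γ := e (i, k)) (t := max s t) hk ?_
  rintro p ⟨⟨⟨⟨-, hpi, hpc⟩, htp⟩, hws⟩, hkp⟩
  obtain ⟨⟨-, hwq⟩, hqi⟩ := hqA p
  refine ⟨x (q p), fun ξ hξ => ?_⟩
  have hξp := hwq p htp.le (hq p) ξ hξ
  refine ⟨(hq p).le.trans (hx _ ξ hξ), fun α h₁ h₂ => ?_, fun w => ?_⟩
  · rw [hξp, hwq α ((le_max_right _ _).trans h₁) (h₂.trans (hq p)) ξ hξ,
      hws α ((le_max_left _ _).trans h₁) h₂, List.append_assoc]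
  · have hidx : ((walk r ξ p ++ p :: w).map h).idxOf i + k.down =
        (walk r ξ (q p)).length + (walk r (q p) p).length := by
      have hmem : i ∈ (walk r (q p) p).map h ++ [h p] := by simp [hpi]
      rw [hξp, List.append_assoc, List.map_append, List.idxOf_append_of_notMem (hqi ξ hξ),
        List.map_append, List.map_cons, List.append_cons, List.idxOf_append_of_mem hmem,
        List.length_map, Nat.add_assoc, hkp]
    rw [Equiv.symm_apply_apply, hidx, hξp, List.append_assoc,
      List.getElem?_append_right (Nat.le_add_right _ _), Nat.add_sub_cancel_left,
      List.getElem?_append_right le_rfl, Nat.sub_self]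
    simpa using hpc

end SteppingUp

/-! ### Monotonicity and bounds on the parameters -/

section Monotonicity

variable {κ θ θ₁ σ σ₁ : Cardinal.{u}}

theorem Realizes.comp {d : List (Below κ) → Below θ} {T T₁ : Set (Set (Below κ))}
    (hd : Realizes d σ T) {f : Below θ → Below θ₁} (hf : Function.Surjective f) (hσ : σ₁ ≤ σ)
    (hT : ∀ E₁ ∈ T₁, ∃ E ∈ T, E ⊆ E₁) : Realizes (f ∘ d) σ₁ T₁ := by
  intro u v huv hmem γ E₁ hE₁
  obtain ⟨γ, rfl⟩ := hf γ
  obtain ⟨E, hE, hsub⟩ := hT E₁ hE₁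
  obtain ⟨α, hα, β, hβ, hlt, h⟩ := hd u v (fun α => (huv α).trans_le hσ) hmem γ E hE
  exact ⟨α, hsub hα, β, hsub hβ, hlt, fun ν hν ρ hρ => congrArg f (h ν hν ρ hρ)⟩

theorem exists_surjective_below (hθ₁ : θ₁ ≠ 0) (hθ : θ₁ ≤ θ) :
    ∃ f : Below θ → Below θ₁, Function.Surjective f := by
  obtain ⟨g⟩ : Nonempty (Below θ₁ ↪ Below θ) := by
    rwa [← Cardinal.le_def, mk_ord_toType, mk_ord_toType]
  have := nonempty_below hθ₁
  exact ⟨Function.invFun g, Function.invFun_surjective g.injective⟩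

theorem exists_realizes_mono (hθ₁ : θ₁ ≠ 0) (hθ : θ₁ ≤ θ) (hσ : σ₁ ≤ σ)
    {T T₁ : Set (Set (Below κ))} (hT : ∀ E₁ ∈ T₁, ∃ E ∈ T, E ⊆ E₁)
    (h : ∃ d : List (Below κ) → Below θ, Realizes d σ T) :
    ∃ d : List (Below κ) → Below θ₁, Realizes d σ₁ T₁ := by
  obtain ⟨f, hf⟩ := exists_surjective_below hθ₁ hθ
  obtain ⟨d, hd⟩ := h
  exact ⟨f ∘ d, hd.comp hf hσ hT⟩

theorem pr6Set_mono (hθ₁ : θ₁ ≠ 0) (hθ : θ₁ ≤ θ) (hσ : σ₁ ≤ σ) {S S₁ : Set (Below κ)}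
    (hS : S ⊆ S₁) (h : Pr6Set κ θ σ S) : Pr6Set κ θ₁ σ₁ S₁ :=
  exists_realizes_mono hθ₁ hθ hσ (by
    rintro _ ⟨E, hE, rfl⟩
    exact ⟨_, ⟨E, hE, rfl⟩, inter_subset_inter_right _ hS⟩) h

theorem pr6Cof_mono (hθ₁ : θ₁ ≠ 0) (hθ : θ₁ ≤ θ) (hσ : σ₁ ≤ σ) {τ τ₁ : Cardinal.{u}}
    (hτ : τ₁ ≤ τ) (h : Pr6Cof κ θ σ τ) : Pr6Cof κ θ₁ σ₁ τ₁ := by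
  obtain ⟨S, hS, hcof, h⟩ := h
  exact ⟨S, hS, fun δ hδ => hτ.trans (hcof δ hδ), pr6Set_mono hθ₁ hθ hσ subset_rfl h⟩

theorem realizes_iff_realizesDiag (d : List (Below κ) → Below θ) (T : Set (Set (Below κ))) :
    Realizes d σ T ↔ RealizesDiag d σ T := by
  constructor
  · intro h u hu hmem γ E hE
    exact h u u (fun α => by rw [union_self]; exact hu α)
      (fun α ν hν => hmem α ν (by rwa [union_self] at hν)) γ E hE
  · intro h u v huv hmem γ E hE
    obtain ⟨α, hα, β, hβ, hlt, h'⟩ := h (fun α => u α ∪ v α) huv hmem γ E hE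
    exact ⟨α, hα, β, hβ, hlt, fun ν hν ρ hρ => h' ν (Or.inl hν) ρ (Or.inr hρ)⟩

theorem Pr1.mono {μ : Cardinal.{u}} (h : Pr1 κ μ θ σ) (hσ : σ₁ ≤ σ) : Pr1 κ μ θ σ₁ := by
  obtain ⟨d, hd, h⟩ := h
  exact ⟨d, hd, fun u hu => h u fun α => (hu α).trans_le hσ⟩

/-- Singletons `{[α]}` show that `d` takes every value on sequences of length two. -/
theorem Realizes.theta_le (hκ : ℵ₀ ≤ κ) (hσ : 2 ≤ σ) {d : List (Below κ) → Below θ}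
    (hd : Realizes d σ {Set.univ}) : θ ≤ κ := by
  have hsurj : Function.Surjective fun p : Below κ × Below κ => d [p.1, p.2] := by
    intro γ
    obtain ⟨α, -, β, -, -, h⟩ := hd (fun α => {[α]}) (fun α => {[α]})
      (fun α => by
        rw [union_self, mk_singleton]
        exact (Nat.one_lt_ofNat (α := Cardinal.{u})).trans_le hσ)
      (by simp) γ Set.univ rfl
    exact ⟨(α, β), h [α] rfl [β] rfl⟩
  have := mk_le_of_surjective hsurj
  rwa [mk_prod, lift_id, mk_ord_toType, mk_ord_toType, mul_eq_self hκ] at this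

/-- Otherwise `u α` may consist of all sequences containing `α`, and two different colours are
forced on one concatenation. -/
theorem Realizes.sigma_le (hκ : ℵ₀ ≤ κ) (hθ : 2 ≤ θ) {d : List (Below κ) → Below θ}
    (hd : Realizes d σ {Set.univ}) : σ ≤ κ := by
  by_contra! hlt
  have hinf : Infinite (Below κ) := by rwa [infinite_iff, mk_ord_toType]
  have key : ∀ γ, ∃ α β, ∀ ν ρ, α ∈ ν → β ∈ ρ → d (ν ++ ρ) = γ := fun γ => by
    obtain ⟨α, -, β, -, -, h⟩ := hd (fun α => {ν | α ∈ ν}) (fun α => {ν | α ∈ ν})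
      (fun α => by
        refine ((mk_set_le _).trans ?_).trans_lt hlt
        rw [mk_list_eq_mk, mk_ord_toType])
      (by simp) γ Set.univ rfl
    exact ⟨α, β, fun ν ρ hν hρ => h ν hν ρ hρ⟩
  obtain ⟨γ, γ', hne⟩ : ∃ γ γ' : Below θ, γ ≠ γ' := by
    rwa [← two_le_iff, mk_ord_toType]
  obtain ⟨α, β, h⟩ := key γ
  obtain ⟨α', β', h'⟩ := key γ'
  exact hne ((h [α, α'] [β, β'] (by simp) (by simp)).symm.trans
    (h' [α, α'] [β, β'] (by simp) (by simp)))

theorem HasUncoveredFamily.two_le_theta {μ : Cardinal.{u}} (hμ : 2 ≤ μ) (hσ : 3 ≤ σ)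
    (h : HasUncoveredFamily μ θ σ) : 2 ≤ θ := by
  obtain ⟨A, hA⟩ := h
  obtain ⟨α, β, hne⟩ : ∃ α β : Below μ, α ≠ β := by
    rwa [← two_le_iff, mk_ord_toType]
  have hcard : #({α, β} : Set (Below μ)) < σ := by
    rw [mk_insert (by simpa using hne), mk_singleton, one_add_one_eq_two]
    exact lt_of_lt_of_le (by exact_mod_cast Nat.lt_succ_self 2) hσ
  obtain ⟨γ, hγ, hγ'⟩ := hA _ hcard α (by simp)
  obtain ⟨γ₁, hγ₁, -⟩ := hA _ hcard β (by simp)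
  have hγβ : γ ∉ A β := fun h => hγ' (mem_biUnion ⟨by simp, by simpa using hne.symm⟩ h)
  rw [← mk_ord_toType θ, two_le_iff]
  exact ⟨γ, γ₁, fun h => hγβ (h ▸ hγ₁)⟩

end Monotonicity

/-! ### Assembly of the stepping-up results -/

theorem Pr6.exists_realizes_univ {κ θ σ : Cardinal.{u}} (h : Pr6 κ θ σ) :
    ∃ d : List (Below κ) → Below θ, Realizes d σ {Set.univ} :=
  let ⟨d, hd⟩ := h
  ⟨d, fun u v h₁ h₂ γ E hE => hd u v h₁ h₂ γ E (by rw [hE]; exact IsClub.univ)⟩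

theorem Pr6.pr1_succ {l θ σ : Cardinal.{u}} (hl : ℵ₀ ≤ l) (h : Pr6 (Order.succ l) θ σ)
    (hA : HasUncoveredFamily (Order.succ (Order.succ l)) θ σ) :
    Pr1 (Order.succ (Order.succ l)) (Order.succ (Order.succ l)) (Order.succ (Order.succ l)) σ := by
  have hκ := isRegular_succ hl
  have hκ₀ := hκ.aleph0_le
  -- For finite `σ` the points on the walks may number `σ` or more, so an uncovered family does not
  -- suffice to select one of them.
  rcases le_or_gt σ ℵ₀ with hσ | hσ
  · exact (pr1_aleph0 hκ (Order.succ_le_succ hl)).mono hσ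
  · obtain ⟨d, hd⟩ := h.exists_realizes_univ
    have h3 : (3 : Cardinal.{u}) ≤ σ := (natCast_lt_aleph0 (n := 3)).le.trans hσ.le
    have h2 : (2 : Cardinal.{u}) ≤ σ := (natCast_lt_aleph0 (n := 2)).le.trans hσ.le
    have hμ : (2 : Cardinal.{u}) ≤ Order.succ (Order.succ l) :=
      (natCast_lt_aleph0 (n := 2)).le.trans (hκ₀.trans (Order.le_succ _))
    exact pr1_of_hasUncoveredFamily hκ hσ.le (hd.sigma_le hκ₀ (hA.two_le_theta hμ h3))
      (hd.theta_le hκ₀ h2) hd hA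

theorem hasUncoveredFamily_succ_succ {l : Cardinal.{u}} (hl : ℵ₀ ≤ l) :
    HasUncoveredFamily (Order.succ (Order.succ l)) (Order.succ l) l :=
  (hasUncoveredFamily_succ (isRegular_succ hl)).mono (Order.le_succ l)

end ShelahPr

theorem lemma2p2 :
    -- (0) monotonicity; a colouring into the empty set does not exist, so `θ₁ ≠ 0`
    (∀ κ θ θ₁ σ σ₁ : Cardinal.{u}, θ₁ ≠ 0 → θ₁ ≤ θ → σ₁ ≤ σ →
      (ShelahPr.Pr6 κ θ σ → ShelahPr.Pr6 κ θ₁ σ₁) ∧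
      (∀ S S₁ : Set (ShelahPr.Below κ), S ⊆ S₁ →
        ShelahPr.Pr6Set κ θ σ S → ShelahPr.Pr6Set κ θ₁ σ₁ S₁) ∧
      (∀ τ τ₁ : Cardinal.{u}, τ₁ ≤ τ →
        ShelahPr.Pr6Cof κ θ σ τ → ShelahPr.Pr6Cof κ θ₁ σ₁ τ₁) ∧
      (ShelahPr.Pr6CofSelf κ θ σ → ShelahPr.Pr6CofSelf κ θ₁ σ₁) ∧
      (ShelahPr.Pr6Nacc κ θ σ → ShelahPr.Pr6Nacc κ θ₁ σ₁) ∧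
      (ShelahPr.Pr6Minus κ θ σ → ShelahPr.Pr6Minus κ θ₁ σ₁)) ∧
    -- (0) without loss of generality `u α = v α`, in `Pr₆` and in all its variants
    (∀ (κ θ σ : Cardinal.{u}) (d : List (ShelahPr.Below κ) → ShelahPr.Below θ)
      (T : Set (Set (ShelahPr.Below κ))),
      ShelahPr.Realizes d σ T ↔ ShelahPr.RealizesDiag d σ T) ∧
    -- (1)
    (∀ l : Cardinal.{u}, ℵ₀ ≤ l →
      ShelahPr.Pr6 (Order.succ l) (Order.succ l) l →
      ShelahPr.Pr1 (Order.succ (Order.succ l)) (Order.succ (Order.succ l))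
        (Order.succ (Order.succ l)) l) ∧
    -- (2)
    (∀ l θ σ : Cardinal.{u}, ℵ₀ ≤ l →
      ShelahPr.Pr6 (Order.succ l) θ σ →
      (2 ≤ σ → θ ≤ Order.succ l) ∧
      (ShelahPr.HasUncoveredFamily (Order.succ (Order.succ l)) θ σ →
        ShelahPr.Pr1 (Order.succ (Order.succ l)) (Order.succ (Order.succ l))
          (Order.succ (Order.succ l)) σ)) ∧
    -- the family required in (2) exists for `θ = λ⁺`, `σ = λ`
    (∀ l : Cardinal.{u}, ℵ₀ ≤ l →
      ShelahPr.HasUncoveredFamily (Order.succ (Order.succ l)) (Order.succ l) l) ∧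
    -- (3)
    (∀ l : Cardinal.{u}, l.IsRegular → l ^< l = l →
      ShelahPr.Pr6 (Order.succ l) (Order.succ l) l) := by
  open ShelahPr in
  refine ⟨fun κ θ θ₁ σ σ₁ hθ₁ hθ hσ => ⟨?_, fun S S₁ hS => pr6Set_mono hθ₁ hθ hσ hS,
    fun τ τ₁ hτ => pr6Cof_mono hθ₁ hθ hσ hτ, pr6Cof_mono hθ₁ hθ hσ hσ, ?_, ?_⟩,
    fun κ θ σ d T => realizes_iff_realizesDiag d T,
    fun l hl h => h.pr1_succ hl (hasUncoveredFamily_succ_succ hl),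
    fun l θ σ hl h => ⟨fun hσ => ?_, h.pr1_succ hl⟩,
    fun l => hasUncoveredFamily_succ_succ, fun l => pr6_succ_of_powerlt⟩
  · exact exists_realizes_mono hθ₁ hθ hσ fun E hE => ⟨E, hE, subset_rfl⟩
  · exact exists_realizes_mono hθ₁ hθ hσ fun E hE => ⟨E, hE, subset_rfl⟩
  · exact exists_realizes_mono hθ₁ hθ hσ fun E hE => ⟨E, hE, subset_rfl⟩
  · obtain ⟨d, hd⟩ := h.exists_realizes_univ
    exact hd.theta_le (hl.trans (Order.le_succ l)) hσ
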